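/- **Setting.** Let $m,N\ge 1$, let $\mathcal A$ be a finite set and $\mathcal X$ a measurable space, and let $(X,A,Y,K)$ be a random tuple in $\mathcal X\times\mathcal A\times[m]\times[N]$ (features, sensitive attribute, label, client) with $\mathbb P(A=a,K=k)>0$ for all $a,k$. Put $p_{a|k}=\mathbb P(A=a\mid K=k)$ and $p_{\min}=\min_{a,k}p_{a|k}$. Let $\eta_y(x,a,k)=\mathbb P(Y=y\mid X=x,A=a,K=k)$ be the Bayes score, and let $\widehat\eta$ be a fixed (pre-trained) score estimator with values in the simplex $\Delta_m$ such that, for all $a,k$, the law of $\widehat\eta(X,a,k)$ given $A=a,K=k$ is absolutely continuous with respect to $(m-1)$-dimensional Lebesgue measure on $\Delta_m$. For a tuple $\mathbf h=(h_1,\dots,h_N)$ of randomized attribute-aware classifiers $h_k:\mathcal X\times\mathcal A\to\Delta_m$ let $\mathbf C^{a,k}_{i,j}(h_k)=\mathbb P(Y=i,\widehat Y=j\mid A=a,K=k)$. Let $\mathcal U_g,\mathcal U_{l,1},\dots,\mathcal U_{l,N}$ be finite index sets with real $m\times m$ matrices $\mathbf D^{a,k}_{u}$ for $u\in\mathcal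 U_g$ and for $u\in\mathcal U_{l,k}$, let $\xi^g,\xi^{l,k}>0$, and put, with Frobenius inner products, $$\mathscr D^g_u(\mathbf h)=\sum_{a,k}\langle\mathbf D^{a,k}_u,\mathbf C^{a,k}(h_k)\rangle\ (u\in\mathcal U_g),\qquad \mathscr D^{l,k}_u(\mathbf h)=\sum_a\langle\mathbf D^{a,k}_u,\mathbf C^{a,k}(h_k)\rangle\ (u\in\mathcal U_{l,k}).$$ Each client $k$ holds $n$ i.i.d. samples $(x_{k,i},a_{k,i},y_{k,i})$ from the law of $(X,A,Y)$ given $K=k$; $n_{a,k}$ is the number of those with attribute $a$, and $n_{\min}=\min_{a,k}n_{a,k}$. Let $\widehat p_{a,k}>0$ and $\widehat{\mathbf D}^{a,k}_u$ be arbitrary, possibly data-dependent, estimates of $\mathbb P(A=a,K=k)$ and $\mathbf D^{a,k}_u$. For non-negative dual parameters $\lambda=(\lambda^{(1)},\lambda^{(2)})$, $\mu=(\mu^{(1)},\mu^{(2)})$ put $$\widehat{\mathbf M}^{\lambda,\mu}(a,k)=\mathbf I-\tfrac1{\widehat p_{a,k}}\Big[\sum_{u\in\mathcal U_g}(\lambda^{(1)}_u-\lambda^{(2)}_u)\widehat{\mathbf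 D}^{a,k}_u-\sum_{u\in\mathcal U_{l,k}}(\mu^{(1)}_{k,u}-\mu^{(2)}_{k,u})\widehat{\mathbf D}^{a,k}_u\Big],$$ $$\widehat H(\lambda,\mu)=\sum_{k,a}\frac{\widehat p_{a,k}}{n_{a,k}}\sum_{i:\,a_{k,i}=a}\max_y\big(\widehat{\mathbf M}^{\lambda,\mu}(a,k)^\top\widehat\eta(x_{k,i},a,k)\big)_y+\xi^g\sum_{u\in\mathcal U_g}(\lambda^{(1)}_u+\lambda^{(2)}_u)+\sum_k\xi^{l,k}\sum_{u\in\mathcal U_{l,k}}(\mu^{(1)}_{k,u}+\mu^{(2)}_{k,u}).$$ Let $(\widehat\lambda^*,\widehat\mu^*)$ minimize $\widehat H$ over all non-negative $(\lambda,\mu)$ and be non-singular, i.e. no $\widehat{\mathbf M}^{\widehat\lambda^*,\widehat\mu^*}(a,k)$ has two equal columns. Let $\widehat{\mathbf h}^*$ be any measurable plug-in classifier: $\widehat h^*_k(x,a)$ is supported on $\arg\max_y\big(\widehat{\mathbf M}^{\widehat\lambda^*,\widehat\mu^*}(a,k)^\top\widehat\eta(x,a,k)\big)_y$. With entrywise norms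 put, for $u\in\mathcal U_g$, $B_g=\max_{a,k}\|\mathbf D^{a,k}_u\|_1$, $\widehat B_g=\max_{a,k}\|\widehat{\mathbf D}^{a,k}_u\|_1$, $\Omega^g_n=\sum_{a,k}\|\mathbf D^{a,k}_u-\widehat{\mathbf D}^{a,k}_u\|_\infty$, $\varepsilon_g=\max_{a,k,i}\mathbb E[|\widehat\eta_i-\eta_i|(X,a,k)\mid A=a,K=k]$; for $u\in\mathcal U_{l,k}$ define $B_{l,k},\widehat B_{l,k},\Omega^{l,k}_n,\varepsilon_{l,k}$ in the same way with $k$ fixed (maxima over $a$, resp. $a,i$; sum over $a$). Put $$\rho(n,\delta)=\sqrt{\tfrac{8|\mathcal A|m^2\log(n+1)}{n}}+\sqrt{\tfrac{2\log(m^2|\mathcal A|N/\delta)}{n}}.$$ **Theorem.** There is a function $C:(0,\infty)\to(0,\infty)$ such that the following holds for all data as above, with constant $C=C(p_{\min})$ depending on $p_{\min}$ only. Let $0<\delta<1$. (1) With probability at least $1-2|\mathcal A|\delta$: if $n_{\min}\ge1$, then for every $u\in\mathcal U_g$ with $n>\frac{2|\mathcal A|N\widehat B_g}{p_{\min}\xi^g}+\frac1{2p_{\min}^2}\log\frac1\delta$,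 $$|\mathscr D^g_u(\widehat{\mathbf h}^*)|\le\xi^g+C\,|\mathcal A|NB_g\,\rho\Big(n,\frac{\delta}{|\mathcal A||\mathcal U_g|}\Big)+\Omega^g_n+\frac{|\mathcal A|N\widehat B_g}{n_{\min}}+|\mathcal A|NB_g\,\varepsilon_g.$$ (2) For each client $k$, with probability at least $1-2|\mathcal A|\delta$: if $n_{\min}\ge1$, then for every $u\in\mathcal U_{l,k}$ with $n>\frac{2|\mathcal A|\widehat B_{l,k}}{p_{\min}\xi^{l,k}}+\frac1{2p_{\min}^2}\log\frac1\delta$, $$|\mathscr D^{l,k}_u(\widehat{\mathbf h}^*)|\le\xi^{l,k}+C\,|\mathcal A|B_{l,k}\,\rho\Big(n,\frac{N\delta}{|\mathcal A||\mathcal U_{l,k}|}\Big)+\Omega^{l,k}_n+\frac{|\mathcal A|\widehat B_{l,k}}{n_{\min}}+|\mathcal A|B_{l,k}\,\varepsilon_{l,k}.$$ The exceptional event may be chosen independently of the estimates $\widehat p,\widehat{\mathbf D}$, of the minimizer and of the classifier. When $\widehat\eta=\eta$, the terms with $\varepsilon_g,\varepsilon_{l,k}$ vanish. -/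

import Mathlib

open MeasureTheory ProbabilityTheory

noncomputable section

namespace FedFair

variable {𝒳 𝒜 : Type*} [MeasurableSpace 𝒳] [MeasurableSpace 𝒜] {m N : ℕ}

/-! ### The population

A point of the population is a tuple `(x, a, y, k)`: features, sensitive attribute, label, client.
-/

/-- The event `K = k`. -/
def clientSet (𝒳 𝒜 : Type*) (m : ℕ) {N : ℕ} (k : Fin N) : Set (𝒳 × 𝒜 × Fin m × Fin N) :=
  {z | z.2.2.2 = k}

/-- The event `A = a, K = k`. -/
def groupSet (𝒳 : Type*) {𝒜 : Type*} (m : ℕ) {N : ℕ} (a : 𝒜) (k : Fin N) :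
    Set (𝒳 × 𝒜 × Fin m × Fin N) :=
  {z | z.2.1 = a ∧ z.2.2.2 = k}

/-- The local distribution of client `k`: the law of `(X, A, Y)` given `K = k`. -/
def localLaw (P : Measure (𝒳 × 𝒜 × Fin m × Fin N)) (k : Fin N) : Measure (𝒳 × 𝒜 × Fin m) :=
  (cond P (clientSet 𝒳 𝒜 m k)).map fun z => (z.1, z.2.1, z.2.2.1)

/-- `p_{a|k} = ℙ(A = a | K = k)`. -/
def groupProb (P : Measure (𝒳 × 𝒜 × Fin m × Fin N)) (a : 𝒜) (k : Fin N) : ℝ :=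
  (cond P (clientSet 𝒳 𝒜 m k)).real {z | z.2.1 = a}

/-- `p_min = min_{a,k} p_{a|k}`. -/
def pMin (P : Measure (𝒳 × 𝒜 × Fin m × Fin N)) : ℝ :=
  ⨅ ak : 𝒜 × Fin N, groupProb P ak.1 ak.2

/-- `η` is (a version of) the Bayes score `η_y(x,a,k) = ℙ(Y = y | X = x, A = a, K = k)`. -/
structure IsBayesScore (P : Measure (𝒳 × 𝒜 × Fin m × Fin N))
    (η : 𝒳 → 𝒜 → Fin N → Fin m → ℝ) : Prop where
  measurable : ∀ a k, Measurable fun x => η x a k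
  mem_simplex : ∀ x a k, η x a k ∈ stdSimplex ℝ (Fin m)
  setIntegral_eq : ∀ (a : 𝒜) (k : Fin N) (y : Fin m) (s : Set 𝒳), MeasurableSet s →
    ∫ z in {z : 𝒳 × 𝒜 × Fin m × Fin N | z.1 ∈ s ∧ z.2.1 = a ∧ z.2.2.2 = k}, η z.1 a k y ∂P
      = P.real {z | z.1 ∈ s ∧ z.2.1 = a ∧ z.2.2.2 = k ∧ z.2.2.1 = y}

/-- A score estimator satisfying the continuity assumption: a measurable map into the simplex
whose law under `ℙ(X ∈ · | A = a, K = k)` is absolutely continuous with respect to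
`(m-1)`-dimensional Lebesgue (Hausdorff) measure on the simplex, for all `a`, `k`. -/
structure IsContinuousScore (P : Measure (𝒳 × 𝒜 × Fin m × Fin N))
    (η : 𝒳 → 𝒜 → Fin N → Fin m → ℝ) : Prop where
  measurable : ∀ a k, Measurable fun x => η x a k
  mem_simplex : ∀ x a k, η x a k ∈ stdSimplex ℝ (Fin m)
  absolutelyContinuous : ∀ a k,
    (cond P (groupSet 𝒳 m a k)).map (fun z => η z.1 a k) ≪
      (Measure.hausdorffMeasure ((m : ℝ) - 1)).restrict (stdSimplex ℝ (Fin m))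

/-- `E[|η̂_i(X,a,k) - η_i(X,a,k)| | A = a, K = k]`. -/
def scoreDist (P : Measure (𝒳 × 𝒜 × Fin m × Fin N)) (ηhat η : 𝒳 → 𝒜 → Fin N → Fin m → ℝ)
    (a : 𝒜) (k : Fin N) (i : Fin m) : ℝ :=
  ∫ z, |ηhat z.1 a k i - η z.1 a k i| ∂(cond P (groupSet 𝒳 m a k))

/-! ### Confusion matrices and disparities -/

/-- Frobenius inner product. -/
def frob (A B : Matrix (Fin m) (Fin m) ℝ) : ℝ := ∑ i, ∑ j, A i j * B i j

/-- Entrywise `ℓ¹` norm. -/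
def l1Norm (A : Matrix (Fin m) (Fin m) ℝ) : ℝ := ∑ i, ∑ j, |A i j|

/-- Entrywise `ℓ^∞` norm. -/
def lInfNorm (A : Matrix (Fin m) (Fin m) ℝ) : ℝ := ⨆ ij : Fin m × Fin m, |A ij.1 ij.2|

/-- The decentralized group-specific confusion matrix
`C^{a,k}_{i,j}(h) = ℙ(Y = i, Ŷ = j | A = a, K = k)` of a randomized attribute-aware classifier
`h`, where `ℙ(Ŷ = j | X = x, A = a) = h x a j`. -/
def confusion (P : Measure (𝒳 × 𝒜 × Fin m × Fin N)) (h : 𝒳 → 𝒜 → Fin m → ℝ)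
    (a : 𝒜) (k : Fin N) : Matrix (Fin m) (Fin m) ℝ :=
  fun i j => ∫ z, (if z.2.2.1 = i then h z.1 z.2.1 j else 0) ∂(cond P (groupSet 𝒳 m a k))

/-- The disparity `∑_a ∑_k ⟨D^{a,k}, C^{a,k}(h_k)⟩` of one global constraint. -/
def globalDisparity [Fintype 𝒜] (P : Measure (𝒳 × 𝒜 × Fin m × Fin N))
    (D : 𝒜 → Fin N → Matrix (Fin m) (Fin m) ℝ) (h : Fin N → 𝒳 → 𝒜 → Fin m → ℝ) : ℝ :=
  ∑ a, ∑ k, frob (D a k) (confusion P (h k) a k)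

/-- The disparity `∑_a ⟨D^{a,k}, C^{a,k}(h_k)⟩` of one local constraint of client `k`. -/
def localDisparity [Fintype 𝒜] (P : Measure (𝒳 × 𝒜 × Fin m × Fin N)) (k : Fin N)
    (D : 𝒜 → Matrix (Fin m) (Fin m) ℝ) (h : Fin N → 𝒳 → 𝒜 → Fin m → ℝ) : ℝ :=
  ∑ a, frob (D a) (confusion P (h k) a k)

/-! ### The empirical dual problem -/

/-- The dual parameters `λ^{(1)}, λ^{(2)}, μ^{(1)}, μ^{(2)}`. -/
structure Dual (Ug : Type*) {N : ℕ} (Ul : Fin N → Type*) where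
  lam₁ : Ug → ℝ
  lam₂ : Ug → ℝ
  mu₁ : (k : Fin N) → Ul k → ℝ
  mu₂ : (k : Fin N) → Ul k → ℝ

/-- All dual parameters are non-negative. -/
def Dual.Nonneg {Ug : Type*} {Ul : Fin N → Type*} (θ : Dual Ug Ul) : Prop :=
  (∀ u, 0 ≤ θ.lam₁ u) ∧ (∀ u, 0 ≤ θ.lam₂ u) ∧ (∀ k u, 0 ≤ θ.mu₁ k u) ∧ (∀ k u, 0 ≤ θ.mu₂ k u)

variable {Ug : Type*} [Fintype Ug] {Ul : Fin N → Type*} [∀ k, Fintype (Ul k)]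

/-- The calibration matrix
`M^{λ,μ}(a,k) = I - (1/p_{a,k}) [∑_u (λ¹_u - λ²_u) D_u^{a,k} - ∑_u (μ¹_{k,u} - μ²_{k,u}) D_u^{a,k}]`.
-/
def calib (p : 𝒜 → Fin N → ℝ) (Dg : Ug → 𝒜 → Fin N → Matrix (Fin m) (Fin m) ℝ)
    (Dl : (k : Fin N) → Ul k → 𝒜 → Matrix (Fin m) (Fin m) ℝ) (θ : Dual Ug Ul)
    (a : 𝒜) (k : Fin N) : Matrix (Fin m) (Fin m) ℝ :=
  1 - (1 / p a k) • (∑ u, (θ.lam₁ u - θ.lam₂ u) • Dg u a k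
    - ∑ u, (θ.mu₁ k u - θ.mu₂ k u) • Dl k u a)

/-- The scores `M(a,k)ᵀ η(x,a,k)`. -/
def score (M : 𝒜 → Fin N → Matrix (Fin m) (Fin m) ℝ) (η : 𝒳 → 𝒜 → Fin N → Fin m → ℝ)
    (x : 𝒳) (a : 𝒜) (k : Fin N) : Fin m → ℝ :=
  Matrix.mulVec (M a k).transpose (η x a k)

/-- The indices of the samples of client `k` that lie in group `a`. -/
def groupIdx [DecidableEq 𝒜] {n : ℕ} (s : Fin N → Fin n → 𝒳 × 𝒜 × Fin m) (a : 𝒜) (k : Fin N) :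
    Finset (Fin n) :=
  Finset.univ.filter fun i => (s k i).2.1 = a

/-- `n_min = min_{a,k} n_{a,k}`, the smallest group sample size over all clients. -/
def nMin [DecidableEq 𝒜] {n : ℕ} (s : Fin N → Fin n → 𝒳 × 𝒜 × Fin m) : ℕ :=
  ⨅ ak : 𝒜 × Fin N, (groupIdx s ak.1 ak.2).card

/-- The empirical plug-in dual objective
`Ĥ(λ,μ) = ∑_k ∑_a p̂_{a,k} (1/n_{a,k}) ∑_{i : a_i = a} max_y (M̂^{λ,μ}(a,k)ᵀ η̂(x_i,a,k))_y
  + ξ^g ∑_u (λ¹_u + λ²_u) + ∑_k ξ^{l,k} ∑_u (μ¹_{k,u} + μ²_{k,u})`. -/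
def empDual [Fintype 𝒜] [DecidableEq 𝒜] {n : ℕ} (s : Fin N → Fin n → 𝒳 × 𝒜 × Fin m)
    (ηhat : 𝒳 → 𝒜 → Fin N → Fin m → ℝ) (ξg : ℝ) (ξl : Fin N → ℝ) (phat : 𝒜 → Fin N → ℝ)
    (Dg : Ug → 𝒜 → Fin N → Matrix (Fin m) (Fin m) ℝ)
    (Dl : (k : Fin N) → Ul k → 𝒜 → Matrix (Fin m) (Fin m) ℝ) (θ : Dual Ug Ul) : ℝ :=
  ∑ k, ∑ a, phat a k * ((1 / ((groupIdx s a k).card : ℝ)) *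
      ∑ i ∈ groupIdx s a k, ⨆ y, score (calib phat Dg Dl θ) ηhat (s k i).1 a k y)
    + ξg * ∑ u, (θ.lam₁ u + θ.lam₂ u)
    + ∑ k, ξl k * ∑ u, (θ.mu₁ k u + θ.mu₂ k u)

/-- `θ` minimizes the empirical dual objective over the non-negative orthant. -/
def IsEmpOptimal [Fintype 𝒜] [DecidableEq 𝒜] {n : ℕ} (s : Fin N → Fin n → 𝒳 × 𝒜 × Fin m)
    (ηhat : 𝒳 → 𝒜 → Fin N → Fin m → ℝ) (ξg : ℝ) (ξl : Fin N → ℝ) (phat : 𝒜 → Fin N → ℝ)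
    (Dg : Ug → 𝒜 → Fin N → Matrix (Fin m) (Fin m) ℝ)
    (Dl : (k : Fin N) → Ul k → 𝒜 → Matrix (Fin m) (Fin m) ℝ) (θ : Dual Ug Ul) : Prop :=
  θ.Nonneg ∧ ∀ θ' : Dual Ug Ul, θ'.Nonneg →
    empDual s ηhat ξg ξl phat Dg Dl θ ≤ empDual s ηhat ξg ξl phat Dg Dl θ'

/-- No calibration matrix has two equal columns. -/
def Nonsingular (M : 𝒜 → Fin N → Matrix (Fin m) (Fin m) ℝ) : Prop :=
  ∀ a k (t y : Fin m), t ≠ y → (fun i => M a k i t) ≠ (fun i => M a k i y)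

/-- `h` consists of measurable classifiers predicting a label of maximal score; ties may be
broken in any (deterministic or randomized) measurable way. -/
def IsPlugInClassifier (M : 𝒜 → Fin N → Matrix (Fin m) (Fin m) ℝ)
    (ηhat : 𝒳 → 𝒜 → Fin N → Fin m → ℝ) (h : Fin N → 𝒳 → 𝒜 → Fin m → ℝ) : Prop :=
  (∀ k a, Measurable fun x => h k x a) ∧
  (∀ k x a, h k x a ∈ stdSimplex ℝ (Fin m)) ∧
  ∀ k x a y, h k x a y ≠ 0 → ∀ j, score M ηhat x a k j ≤ score M ηhat x a k y

/-- `ρ(n,δ) = √(8 |𝒜| m² log(n+1) / n) + √(2 log(m² |𝒜| N / δ) / n)`. -/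
def rho (cardA m N n : ℕ) (δ : ℝ) : ℝ :=
  Real.sqrt (8 * cardA * m ^ 2 * Real.log (n + 1) / n)
    + Real.sqrt (2 * Real.log (m ^ 2 * cardA * N / δ) / n)

/-- `max_{a,k} ‖D^{a,k}‖₁`. -/
def normG (D : 𝒜 → Fin N → Matrix (Fin m) (Fin m) ℝ) : ℝ :=
  ⨆ ak : 𝒜 × Fin N, l1Norm (D ak.1 ak.2)

/-- `max_a ‖D^a‖₁`. -/
def normL (D : 𝒜 → Matrix (Fin m) (Fin m) ℝ) : ℝ := ⨆ a : 𝒜, l1Norm (D a)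

/-- `∑_{a,k} ‖D^{a,k} - D̂^{a,k}‖_∞`. -/
def omegaG [Fintype 𝒜] (D Dhat : 𝒜 → Fin N → Matrix (Fin m) (Fin m) ℝ) : ℝ :=
  ∑ a, ∑ k, lInfNorm (D a k - Dhat a k)

/-- `∑_a ‖D^a - D̂^a‖_∞`. -/
def omegaL [Fintype 𝒜] (D Dhat : 𝒜 → Matrix (Fin m) (Fin m) ℝ) : ℝ :=
  ∑ a, lInfNorm (D a - Dhat a)

end FedFair

end

/-! Optimality of the multipliers yields empirical fairness, and a uniform deviation bound carries
it to the population.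

Empirical side. Raising one multiplier of a constraint by a small r > 0 moves the calibration
matrices linearly in r and the penalty by r times the tolerance. At a minimizer the one-sided
derivative of the dual objective is non-negative; it equals the tolerance minus a signed empirical
disparity, computed with `ηhat` in place of the true labels, for some choice of a maximizing label
at every sample point. So for each sign some maximizing selection has signed disparity at most ξ
(`exists_selection_global`, `exists_selection_local`). The selection may depend on the sign, and
ties are resolved in favour of the direction, so tied samples need not be counted.

Passage to the population. The multipliers depend on the data, so the comparison must hold for all
calibration matrices at once. A decision region is an intersection of at most m half-spaces in the
scores, hence a polynomial growth function, and symmetrization gives a uniform deviation inequality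
(`measureReal_exists_deviation_le`). It is applied to rational matrices only, a countable class, so
suprema are measurable. The region of a real matrix is sandwiched between strict rational regions,
and every maximizing selection lies between the two. Both bounds have the same limit because ties
are null: a hyperplane through the origin cuts the simplex in a set of zero (m-1)-dimensional
measure. Thus every maximizing selection and every plug-in classifier have the same score confusion
matrix up to 2ρ / p_min (`abs_empConfusion_sub_le`).

Conclusion (`disparity_le`). With C the true and Ĉ the empirical confusion matrix, ⟨D, C⟩ - ⟨D̂, Ĉ⟩
= ⟨D, C - Ĉ⟩ - ⟨D̂ - D, Ĉ⟩; the first part costs the deviation and the score error, the second at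
most ‖D - D̂‖_∞. The good event concerns only the samples and `ηhat`, so all estimates, minimizers
and classifiers are covered simultaneously. -/

namespace FedFair

/-! ### A uniform deviation inequality -/

/-- Averaging the exponential over all sign patterns. -/
lemma sum_exp_signs_le {n : ℕ} (d : Fin n → ℝ) (hd : ∀ i, |d i| ≤ 1) (s : ℝ) :
    ∑ σ : Fin n → Bool, Real.exp (s * ∑ i, (if σ i then d i else - d i)) ≤
      2 ^ n * Real.exp (n * s ^ 2 / 2) := by
  have h1 : ∀ σ : Fin n → Bool, Real.exp (s * ∑ i, (if σ i then d i else - d i)) =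
      ∏ i, Real.exp (s * (if σ i then d i else - d i)) := by
    intro σ
    rw [Finset.mul_sum, Real.exp_sum]
  simp_rw [h1]
  -- Independence of the signs: summing a product over all patterns gives the product of the
  -- two-term sums, each equal to 2 cosh(s dᵢ).
  have h2 := (Finset.prod_univ_sum (fun _ : Fin n => (Finset.univ : Finset Bool))
    (fun i b => Real.exp (s * (if b then d i else - d i))))
  rw [Fintype.piFinset_univ] at h2
  rw [← h2]
  have h3 : ∀ i, ∑ b : Bool, Real.exp (s * (if b then d i else - d i)) ≤
      2 * Real.exp (s ^ 2 / 2) := by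
    intro i
    have h4 := Real.cosh_le_exp_half_sq (s * d i)
    rw [Real.cosh_eq] at h4
    have h5 : (s * d i) ^ 2 / 2 ≤ s ^ 2 / 2 := by
      have : d i ^ 2 ≤ 1 := by
        rw [← sq_abs]; exact pow_le_one₀ (abs_nonneg _) (hd i)
      rw [mul_pow]
      nlinarith [sq_nonneg s]
    have h6 := Real.exp_le_exp.2 h5
    simp only [Fintype.sum_bool, if_true, Bool.false_eq_true, if_false, mul_neg]
    linarith
  calc ∏ i, ∑ b : Bool, Real.exp (s * (if b then d i else - d i))
      ≤ ∏ _i : Fin n, (2 * Real.exp (s ^ 2 / 2)) :=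
        Finset.prod_le_prod (fun i _ => Finset.sum_nonneg fun b _ => (Real.exp_pos _).le)
          (fun i _ => h3 i)
    _ = 2 ^ n * Real.exp (n * s ^ 2 / 2) := by
        rw [Finset.prod_const, Finset.card_univ, Fintype.card_fin, mul_pow, ← Real.exp_nat_mul,
          mul_div_assoc]

section Deviation

variable {S ι : Type*} [MeasurableSpace S] {n : ℕ}

/-- Jensen's inequality against an independent copy of the sample. -/
lemma ofReal_exp_sub_integral_le (ν : Measure S) [IsProbabilityMeasure ν] (f : S → ℝ)
    (hf : Measurable f) (h01 : ∀ x, f x ∈ Set.Icc (0 : ℝ) 1) (s r : ℝ) :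
    ENNReal.ofReal (Real.exp (s * (r - n * ∫ x, f x ∂ν))) ≤
      ∫⁻ x' : Fin n → S, ENNReal.ofReal (Real.exp (s * (r - ∑ i, f (x' i))))
        ∂(Measure.pi fun _ => ν) := by
  have hb : ∀ x, ‖f x‖ ≤ 1 := fun x => by
    rw [Real.norm_eq_abs, abs_le]; constructor <;> linarith [(h01 x).1, (h01 x).2]
  have hsum : Measurable fun x' : Fin n → S => ∑ i, f (x' i) :=
    Finset.measurable_sum _ fun i _ => hf.comp (measurable_pi_apply i)
  have hsb : ∀ x' : Fin n → S, |∑ i, f (x' i)| ≤ n := fun x' => by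
    calc |∑ i, f (x' i)| ≤ ∑ i, |f (x' i)| := Finset.abs_sum_le_sum_abs _ _
      _ ≤ ∑ _i : Fin n, (1 : ℝ) := Finset.sum_le_sum fun i _ => hb _
      _ = n := by simp
  have hint : Integrable (fun x' : Fin n → S => s * (r - ∑ i, f (x' i)))
      (Measure.pi fun _ => ν) := by
    refine Integrable.of_bound (measurable_const.mul
      (measurable_const.sub hsum)).aestronglyMeasurable (|s| * (|r| + n)) (ae_of_all _ fun x' => ?_)
    rw [Real.norm_eq_abs, abs_mul]
    gcongr
    exact (abs_sub _ _).trans (by gcongr; exact hsb x')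
  have hint2 : Integrable (fun x' : Fin n → S => Real.exp (s * (r - ∑ i, f (x' i))))
      (Measure.pi fun _ => ν) := by
    refine Integrable.of_bound (Real.measurable_exp.comp (measurable_const.mul
      (measurable_const.sub hsum))).aestronglyMeasurable (Real.exp (|s| * (|r| + n)))
      (ae_of_all _ fun x' => ?_)
    rw [Real.norm_eq_abs, Real.abs_exp, Real.exp_le_exp]
    refine (le_abs_self _).trans ?_
    rw [abs_mul]
    gcongr
    exact (abs_sub _ _).trans (by gcongr; exact hsb x')
  have hmean : ∫ x' : Fin n → S, s * (r - ∑ i, f (x' i)) ∂(Measure.pi fun _ => ν) =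
      s * (r - n * ∫ x, f x ∂ν) := by
    have hi : ∀ i : Fin n, Integrable (fun x' : Fin n → S => f (x' i))
        (Measure.pi fun _ => ν) := fun i =>
      Integrable.of_bound (hf.comp (measurable_pi_apply i)).aestronglyMeasurable 1
        (ae_of_all _ fun x' => hb _)
    rw [integral_const_mul, integral_sub (integrable_const _) (integrable_finsetSum _ fun i _ => hi i),
      integral_finsetSum _ fun i _ => hi i]
    simp_rw [integral_comp_eval (μ := fun _ : Fin n => ν) hf.aestronglyMeasurable]
    simp
  rw [← hmean, ← ofReal_integral_eq_lintegral_ofReal hint2 (ae_of_all _ fun _ => (Real.exp_pos _).le)]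
  refine ENNReal.ofReal_le_ofReal ?_
  exact convexOn_exp.map_integral_le Real.continuous_exp.continuousOn isClosed_univ
    (ae_of_all _ fun _ => Set.mem_univ _) hint hint2

/-- Exponential moment of the uniform deviation of a countable class of `[0,1]`-valued functions
that shows at most `G` patterns on any `2n` points. -/
theorem lintegral_iSup_exp_le [Countable ι] (ν : Measure S) [IsProbabilityMeasure ν]
    (f : ι → S → ℝ) (hf : ∀ c, Measurable (f c)) (h01 : ∀ c x, f c x ∈ Set.Icc (0 : ℝ) 1) (G : ℕ)
    (hG : ∀ p : Fin n ⊕ Fin n → S, ∃ T : Finset ι, T.card ≤ G ∧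
      ∀ c, ∃ c' ∈ T, ∀ q, f c (p q) = f c' (p q)) (s : ℝ) :
    ∫⁻ x : Fin n → S, ⨆ c, ENNReal.ofReal (Real.exp (s * (∑ i, f c (x i) - n * ∫ y, f c y ∂ν)))
        ∂(Measure.pi fun _ => ν) ≤
      ENNReal.ofReal (G * Real.exp (n * s ^ 2 / 2)) := by
  set Φ : (Fin n → S × S) → ENNReal := fun w =>
    ⨆ c, ENNReal.ofReal (Real.exp (s * (∑ i, f c (w i).1 - ∑ i, f c (w i).2))) with hΦ
  have hΦm : Measurable Φ := by
    refine Measurable.iSup fun c => ENNReal.measurable_ofReal.comp (Real.measurable_exp.comp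
      (measurable_const.mul ((Finset.measurable_sum _ fun i _ => ?_).sub
        (Finset.measurable_sum _ fun i _ => ?_))))
    · exact (hf c).comp (measurable_fst.comp (measurable_pi_apply i))
    · exact (hf c).comp (measurable_snd.comp (measurable_pi_apply i))
  have hΨm : Measurable fun z : (Fin n → S) × (Fin n → S) =>
      ⨆ c, ENNReal.ofReal (Real.exp (s * (∑ i, f c (z.1 i) - ∑ i, f c (z.2 i)))) := by
    refine Measurable.iSup fun c => ENNReal.measurable_ofReal.comp (Real.measurable_exp.comp
      (measurable_const.mul ((Finset.measurable_sum _ fun i _ => ?_).sub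
        (Finset.measurable_sum _ fun i _ => ?_))))
    · exact (hf c).comp ((measurable_pi_apply i).comp measurable_fst)
    · exact (hf c).comp ((measurable_pi_apply i).comp measurable_snd)
  have h1 : ∫⁻ x : Fin n → S, ⨆ c,
        ENNReal.ofReal (Real.exp (s * (∑ i, f c (x i) - n * ∫ y, f c y ∂ν)))
        ∂(Measure.pi fun _ => ν) ≤ ∫⁻ w, Φ w ∂(Measure.pi fun _ : Fin n => ν.prod ν) := by
    -- A sample together with its ghost copy is an i.i.d. sample of pairs, the form in which each
    -- pair can be swapped separately.
    have hmp := measurePreserving_arrowProdEquivProdArrow S S (Fin n) (fun _ => ν) (fun _ => ν)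
    have h2 := hmp.lintegral_comp hΨm
    have h3 : ∫⁻ w, Φ w ∂(Measure.pi fun _ : Fin n => ν.prod ν) =
        ∫⁻ x : Fin n → S, ∫⁻ x' : Fin n → S, ⨆ c,
          ENNReal.ofReal (Real.exp (s * (∑ i, f c (x i) - ∑ i, f c (x' i))))
          ∂(Measure.pi fun _ => ν) ∂(Measure.pi fun _ => ν) := by
      rw [← lintegral_prod _ hΨm.aemeasurable, ← h2]
      rfl
    rw [h3]
    -- Jensen is used for one index at a time; the supremum then moves inside the ghost integral for
    -- free.
    refine lintegral_mono fun x => iSup_le fun c => ?_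
    refine (ofReal_exp_sub_integral_le ν (f c) (hf c) (h01 c) s _).trans ?_
    exact lintegral_mono fun x' => le_iSup (fun c => ENNReal.ofReal
      (Real.exp (s * (∑ i, f c (x i) - ∑ i, f c (x' i))))) c
  refine h1.trans ?_
  set swp : (Fin n → Bool) → (Fin n → S × S) → (Fin n → S × S) :=
    fun σ w i => if σ i then w i else (w i).swap with hswp
  have hmp : ∀ σ, MeasurePreserving (swp σ) (Measure.pi fun _ : Fin n => ν.prod ν)
      (Measure.pi fun _ : Fin n => ν.prod ν) := by
    intro σ
    refine measurePreserving_pi (fun _ : Fin n => ν.prod ν) (fun _ => ν.prod ν)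
      (f := fun i z => if σ i then z else z.swap) fun i => ?_
    by_cases h : σ i
    · simp only [h, if_true]; exact MeasurePreserving.id _
    · simp only [h]; exact Measure.measurePreserving_swap
  -- Swapping only permutes the 2n points, so one finite set T of representatives serves all
  -- patterns, and the supremum is at most a sum over T.
  have hpt : ∀ w, ∑ σ : Fin n → Bool, Φ (swp σ w) ≤
      ENNReal.ofReal (2 ^ n * (G * Real.exp (n * s ^ 2 / 2))) := by
    intro w
    obtain ⟨T, hT, hrep⟩ := hG (Sum.elim (fun i => (w i).1) (fun i => (w i).2))
    have hd : ∀ c σ, ∑ i, f c (swp σ w i).1 - ∑ i, f c (swp σ w i).2 =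
        ∑ i, (if σ i then f c (w i).1 - f c (w i).2 else -(f c (w i).1 - f c (w i).2)) := by
      intro c σ
      rw [← Finset.sum_sub_distrib]
      refine Finset.sum_congr rfl fun i _ => ?_
      by_cases h : σ i <;> simp [hswp, h]
    have hle : ∀ σ, Φ (swp σ w) ≤ ∑ c ∈ T, ENNReal.ofReal (Real.exp (s * ∑ i,
        (if σ i then f c (w i).1 - f c (w i).2 else -(f c (w i).1 - f c (w i).2)))) := by
      intro σ
      refine iSup_le fun c => ?_
      obtain ⟨c', hc', he⟩ := hrep c
      rw [hd]
      have e1 : ∀ i, f c (w i).1 = f c' (w i).1 := fun i => he (Sum.inl i)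
      have e2 : ∀ i, f c (w i).2 = f c' (w i).2 := fun i => he (Sum.inr i)
      simp_rw [e1, e2]
      exact Finset.single_le_sum (f := fun c => ENNReal.ofReal (Real.exp (s * ∑ i,
        (if σ i then f c (w i).1 - f c (w i).2 else -(f c (w i).1 - f c (w i).2)))))
        (fun _ _ => zero_le) hc'
    calc ∑ σ : Fin n → Bool, Φ (swp σ w)
        ≤ ∑ σ : Fin n → Bool, ∑ c ∈ T, ENNReal.ofReal (Real.exp (s * ∑ i,
          (if σ i then f c (w i).1 - f c (w i).2 else -(f c (w i).1 - f c (w i).2)))) :=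
          Finset.sum_le_sum fun σ _ => hle σ
      _ = ENNReal.ofReal (∑ c ∈ T, ∑ σ : Fin n → Bool, Real.exp (s * ∑ i,
          (if σ i then f c (w i).1 - f c (w i).2 else -(f c (w i).1 - f c (w i).2)))) := by
          rw [Finset.sum_comm, ENNReal.ofReal_sum_of_nonneg
            fun c _ => Finset.sum_nonneg fun σ _ => (Real.exp_pos _).le]
          refine Finset.sum_congr rfl fun c _ => ?_
          rw [ENNReal.ofReal_sum_of_nonneg fun σ _ => (Real.exp_pos _).le]
      _ ≤ ENNReal.ofReal (2 ^ n * (G * Real.exp (n * s ^ 2 / 2))) := by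
          refine ENNReal.ofReal_le_ofReal ?_
          calc _ ≤ ∑ _c ∈ T, 2 ^ n * Real.exp (n * s ^ 2 / 2) := by
                refine Finset.sum_le_sum fun c _ => sum_exp_signs_le _ (fun i => ?_) s
                rw [abs_le]
                constructor <;> linarith [(h01 c (w i).1).1, (h01 c (w i).1).2,
                  (h01 c (w i).2).1, (h01 c (w i).2).2]
            _ = T.card * (2 ^ n * Real.exp (n * s ^ 2 / 2)) := by
                rw [Finset.sum_const, nsmul_eq_mul]
            _ ≤ G * (2 ^ n * Real.exp (n * s ^ 2 / 2)) := by
                gcongr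
            _ = _ := by ring
  have havg : (2 : ENNReal) ^ n * ∫⁻ w, Φ w ∂(Measure.pi fun _ : Fin n => ν.prod ν) ≤
      2 ^ n * ENNReal.ofReal (G * Real.exp (n * s ^ 2 / 2)) := by
    calc (2 : ENNReal) ^ n * ∫⁻ w, Φ w ∂(Measure.pi fun _ : Fin n => ν.prod ν)
        = ∑ _σ : Fin n → Bool, ∫⁻ w, Φ w ∂(Measure.pi fun _ : Fin n => ν.prod ν) := by
          rw [Finset.sum_const, nsmul_eq_mul]
          simp
      _ = ∑ σ : Fin n → Bool, ∫⁻ w, Φ (swp σ w) ∂(Measure.pi fun _ : Fin n => ν.prod ν) :=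
          Finset.sum_congr rfl fun σ _ => ((hmp σ).lintegral_comp hΦm).symm
      _ = ∫⁻ w, ∑ σ : Fin n → Bool, Φ (swp σ w) ∂(Measure.pi fun _ : Fin n => ν.prod ν) :=
          (lintegral_finsetSum _ fun σ _ => hΦm.comp (hmp σ).measurable).symm
      _ ≤ ∫⁻ _w, ENNReal.ofReal (2 ^ n * (G * Real.exp (n * s ^ 2 / 2)))
            ∂(Measure.pi fun _ : Fin n => ν.prod ν) := lintegral_mono hpt
      _ = _ := by
          rw [lintegral_const, measure_univ, mul_one, ENNReal.ofReal_mul (by positivity),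
            ENNReal.ofReal_pow (by norm_num)]
          simp
  exact (ENNReal.mul_le_mul_iff_right (by simp) (by simp)).1 havg

/-- Uniform deviation inequality for the empirical means of an i.i.d. sample. -/
theorem measureReal_exists_deviation_le {Ω : Type*} [MeasurableSpace Ω] (Q : Measure Ω)
    [IsProbabilityMeasure Q] (X : Fin n → Ω → S) (hX : ∀ i, Measurable (X i))
    (ν : Measure S) [IsProbabilityMeasure ν] (hlaw : ∀ i, Q.map (X i) = ν) (hind : iIndepFun X Q)
    [Countable ι] (f : ι → S → ℝ) (hf : ∀ c, Measurable (f c))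
    (h01 : ∀ c x, f c x ∈ Set.Icc (0 : ℝ) 1) (G : ℕ)
    (hG : ∀ p : Fin n ⊕ Fin n → S, ∃ T : Finset ι, T.card ≤ G ∧
      ∀ c, ∃ c' ∈ T, ∀ q, f c (p q) = f c' (p q)) (t : ℝ) (ht : 0 ≤ t) :
    Q.real {ω | ∃ c, n * t < |∑ i, f c (X i ω) - n * ∫ y, f c y ∂ν|} ≤
      2 * G * Real.exp (-(n * t ^ 2 / 2)) := by
  have hmap : Q.map (fun ω i => X i ω) = Measure.pi fun _ => ν := by
    rw [(iIndepFun_iff_map_fun_eq_pi_map fun i => (hX i).aemeasurable).1 hind]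
    simp_rw [hlaw]
  have hXm : Measurable fun ω i => X i ω := measurable_pi_lambda _ hX
  -- Chernoff's method: |s| = t minimizes n s² / 2 - n |s| t, and Markov's inequality at level exp(n
  -- t²) leaves exp(-n t² / 2).
  have key : ∀ s : ℝ, (s = t ∨ s = -t) →
      Q.real {ω | ∃ c, n * t ^ 2 < s * (∑ i, f c (X i ω) - n * ∫ y, f c y ∂ν)} ≤
      G * Real.exp (-(n * t ^ 2 / 2)) := by
    intro s hs
    have hs2 : s ^ 2 = t ^ 2 := by rcases hs with rfl | rfl <;> ring
    set Ψ : (Fin n → S) → ENNReal := fun x => ⨆ c, ENNReal.ofReal (Real.exp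
      (s * (∑ i, f c (x i) - n * ∫ y, f c y ∂ν))) with hΨ
    have hm : Measurable Ψ := by
      refine Measurable.iSup fun c => ENNReal.measurable_ofReal.comp (Real.measurable_exp.comp
        (measurable_const.mul ((Finset.measurable_sum _ fun i _ => ?_).sub measurable_const)))
      exact (hf c).comp (measurable_pi_apply i)
    have h1 := lintegral_iSup_exp_le ν f hf h01 G hG s
    rw [← hmap, lintegral_map hm hXm] at h1
    have h2 := mul_meas_ge_le_lintegral₀ (μ := Q) (hm.comp hXm).aemeasurable
      (ENNReal.ofReal (Real.exp (n * t ^ 2)))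
    have hsub : {ω | ∃ c, n * t ^ 2 < s * (∑ i, f c (X i ω) - n * ∫ y, f c y ∂ν)} ⊆
        {ω | ENNReal.ofReal (Real.exp (n * t ^ 2)) ≤ (Ψ ∘ fun ω i => X i ω) ω} := by
      rintro ω ⟨c, hc⟩
      refine le_trans ?_ (le_iSup (fun c => ENNReal.ofReal (Real.exp
        (s * (∑ i, f c (X i ω) - n * ∫ y, f c y ∂ν)))) c)
      exact ENNReal.ofReal_le_ofReal (Real.exp_le_exp.2 hc.le)
    have h3 : ENNReal.ofReal (Real.exp (n * t ^ 2)) *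
        Q {ω | ∃ c, n * t ^ 2 < s * (∑ i, f c (X i ω) - n * ∫ y, f c y ∂ν)} ≤
        ENNReal.ofReal (G * Real.exp (n * s ^ 2 / 2)) :=
      (mul_le_mul_right (measure_mono hsub) _).trans (h2.trans h1)
    have h4 := ENNReal.toReal_mono ENNReal.ofReal_ne_top h3
    rw [ENNReal.toReal_mul, ENNReal.toReal_ofReal (Real.exp_pos _).le,
      ENNReal.toReal_ofReal (by positivity), hs2] at h4
    change Real.exp (n * t ^ 2) * Q.real _ ≤ _ at h4
    have h5 : Real.exp (-(n * t ^ 2 / 2)) =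
        Real.exp (n * t ^ 2 / 2) / Real.exp (n * t ^ 2) := by
      rw [← Real.exp_sub]; congr 1; ring
    rw [h5, ← mul_div_assoc, le_div_iff₀ (Real.exp_pos _), mul_comm]
    exact h4
  -- For t = 0 a strict deviation cannot be multiplied by t. The claimed bound is then 2G, which
  -- exceeds 1 as soon as the class is non-empty.
  rcases ht.eq_or_lt with rfl | htp
  · have hG1 : Set.Nonempty {ω | ∃ c, n * (0 : ℝ) < |∑ i, f c (X i ω) - n * ∫ y, f c y ∂ν|} →
        1 ≤ G := by
      rintro ⟨ω, c, -⟩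
      obtain ⟨T, hT, hr⟩ := hG (Sum.elim (fun i => X i ω) (fun i => X i ω))
      obtain ⟨c', hc', -⟩ := hr c
      exact (Finset.card_pos.2 ⟨c', hc'⟩).trans_le hT
    rcases Set.eq_empty_or_nonempty
      {ω | ∃ c, n * (0 : ℝ) < |∑ i, f c (X i ω) - n * ∫ y, f c y ∂ν|} with h | h
    · rw [h]; simp
    · have := hG1 h
      have h1 : (1 : ℝ) ≤ G := by exact_mod_cast this
      refine measureReal_le_one.trans ?_
      simp
      linarith
  · have hsub : {ω | ∃ c, n * t < |∑ i, f c (X i ω) - n * ∫ y, f c y ∂ν|} ⊆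
        {ω | ∃ c, n * t ^ 2 < t * (∑ i, f c (X i ω) - n * ∫ y, f c y ∂ν)} ∪
        {ω | ∃ c, n * t ^ 2 < -t * (∑ i, f c (X i ω) - n * ∫ y, f c y ∂ν)} := by
      rintro ω ⟨c, hc⟩
      rcases lt_abs.1 hc with h | h
      · left; refine ⟨c, ?_⟩; nlinarith
      · right; refine ⟨c, ?_⟩; nlinarith
    calc _ ≤ _ := measureReal_mono hsub
      _ ≤ _ := measureReal_union_le _ _
      _ ≤ _ := add_le_add (key t (Or.inl rfl)) (key (-t) (Or.inr rfl))
      _ = _ := by ring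

end Deviation

/-! ### Growth of half-spaces and polyhedral cones -/

section Growth

variable {α : Type*} [Fintype α] [DecidableEq α] {m : ℕ}

/-- The points of a family lying in the open half-space with normal `w`. -/
noncomputable def halfspaceTrace (z : α → Fin m → ℝ) (w : Fin m → ℝ) : Finset α :=
  Finset.univ.filter fun q => 0 < w ⬝ᵥ z q

/-- All the traces of open homogeneous half-spaces on a finite family of points. -/
noncomputable def halfspaceTraces (z : α → Fin m → ℝ) : Finset (Finset α) :=
  (Set.toFinite (Set.range (halfspaceTrace z))).toFinset

/-- More than m points in dimension m satisfy a relation ∑ g_q z_q = 0 with some g_q > 0, after a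
change of sign if needed. Shattering supplies w with w · z_q > 0 exactly where g_q > 0, so ∑ g_q (w
· z_q) = 0 has non-negative terms and a positive one. -/
lemma card_le_of_shatters_halfspaceTraces (z : α → Fin m → ℝ) (s : Finset α)
    (hs : (halfspaceTraces z).Shatters s) : s.card ≤ m := by
  by_contra! hlt
  have hdep : ¬ LinearIndependent ℝ (fun q : s => z q) := by
    intro h
    have := h.fintype_card_le_finrank
    simp at this
    omega
  obtain ⟨g, hg0, q₀, hq₀⟩ := Fintype.not_linearIndependent_iff.1 hdep
  have key : ∀ g : s → ℝ, ∑ q, g q • z q = 0 → (∃ q, 0 < g q) → False := by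
    rintro g hg0 ⟨q₁, hq₁⟩
    obtain ⟨u, hu, hsu⟩ := hs (t := (Finset.univ.filter fun q : s => 0 < g q).map
      (Function.Embedding.subtype _)) (by
        intro q hq
        simp only [Finset.mem_map, Function.Embedding.coe_subtype] at hq
        obtain ⟨a, -, rfl⟩ := hq
        exact a.2)
    simp only [halfspaceTraces, Set.Finite.mem_toFinset, Set.mem_range] at hu
    obtain ⟨w, rfl⟩ := hu
    have hiff : ∀ q : s, 0 < w ⬝ᵥ z q ↔ 0 < g q := by
      intro q
      have := Finset.ext_iff.1 hsu q.1
      simpa [halfspaceTrace] using this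
    have h0 : ∑ q : s, g q * (w ⬝ᵥ z q) = 0 := by
      have := congrArg (fun v => w ⬝ᵥ v) hg0
      simpa [dotProduct_sum, dotProduct_smul] using this
    have hnn : ∀ q : s, 0 ≤ g q * (w ⬝ᵥ z q) := by
      intro q
      by_cases h : 0 < g q
      · exact (mul_pos h ((hiff q).2 h)).le
      · exact mul_nonneg_of_nonpos_of_nonpos (not_lt.1 h) (not_lt.1 fun h' => h ((hiff q).1 h'))
    have := Finset.single_le_sum (f := fun q : s => g q * (w ⬝ᵥ z q)) (fun q _ => hnn q)
      (Finset.mem_univ q₁)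
    rw [h0] at this
    exact absurd (mul_pos hq₁ ((hiff q₁).2 hq₁)) (not_lt.2 this)
  rcases lt_or_gt_of_ne hq₀ with h | h
  · refine key (fun q => - g q) ?_ ⟨q₀, by simpa using h⟩
    simp_rw [neg_smul, Finset.sum_neg_distrib, hg0, neg_zero]
  · exact key g hg0 ⟨q₀, h⟩

/-- Termwise comparison with the binomial expansion of (q + 1)^m, using C(q, k) ≤ q^k and C(m, k) ≥
1. -/
lemma sum_choose_le_pow (q m : ℕ) : ∑ k ≤ m, q.choose k ≤ (q + 1) ^ m := by
  rw [add_pow]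
  simp only [one_pow, mul_one]
  have : (Finset.Iic m) = Finset.range (m + 1) := by ext; simp
  rw [this]
  refine Finset.sum_le_sum fun k hk => ?_
  have hk' : k ≤ m := Nat.lt_succ_iff.1 (Finset.mem_range.1 hk)
  exact (Nat.choose_le_pow q k).trans (Nat.le_mul_of_pos_right _ (Nat.choose_pos hk'))

/-- Sauer–Shelah with VC dimension at most m. -/
lemma card_halfspaceTraces_le (z : α → Fin m → ℝ) :
    (halfspaceTraces z).card ≤ (Fintype.card α + 1) ^ m := by
  refine (Finset.card_le_card_shatterer _).trans (Finset.card_shatterer_le_sum_vcDim.trans ?_)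
  refine le_trans (Finset.sum_le_sum_of_subset ?_) (sum_choose_le_pow _ m)
  refine Finset.Iic_subset_Iic.2 (Finset.sup_le fun s hs => ?_)
  exact card_le_of_shatters_halfspaceTraces z s (Finset.mem_shatterer.1 hs)

/-- A point where column `j` of `M` gives the strictly largest score. -/
def StrictMax (M : Matrix (Fin m) (Fin m) ℝ) (j : Fin m) (v : Fin m → ℝ) : Prop :=
  ∀ t, t ≠ j → (M.transpose.mulVec v) t < (M.transpose.mulVec v) j

/-- A point where column `j` of `M` gives a largest score. -/
def WeakMax (M : Matrix (Fin m) (Fin m) ℝ) (j : Fin m) (v : Fin m → ℝ) : Prop :=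
  ∀ t, (M.transpose.mulVec v) t ≤ (M.transpose.mulVec v) j

/-- Strict maximality of column j says that the point lies in the open half-spaces normal to (column
j) - (column t), t ≠ j. The m-tuple of their traces therefore determines the pattern, and T picks
one index for each tuple that occurs. The trace at t = j is carried along only to keep the tuple
indexed by all of `Fin m`. -/
lemma exists_representatives_strictMax {ι : Type*} (M : ι → Matrix (Fin m) (Fin m) ℝ) (j : Fin m)
    (z : α → Fin m → ℝ) :
    ∃ T : Finset ι, T.card ≤ (Fintype.card α + 1) ^ (m * m) ∧
      ∀ c, ∃ c' ∈ T, ∀ q, StrictMax (M c) j (z q) ↔ StrictMax (M c') j (z q) := by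
  classical
  set pat : ι → (Fin m → Finset α) := fun c t => halfspaceTrace z (fun i => M c i j - M c i t)
    with hpat
  have hmem : ∀ c, pat c ∈ Fintype.piFinset fun _ : Fin m => halfspaceTraces z := by
    intro c
    rw [Fintype.mem_piFinset]
    intro t
    simp only [halfspaceTraces, Set.Finite.mem_toFinset, Set.mem_range]
    exact ⟨_, rfl⟩
  have hfin : (Set.range pat).Finite :=
    (Finset.finite_toSet (Fintype.piFinset fun _ : Fin m => halfspaceTraces z)).subset
      (by rintro _ ⟨c, rfl⟩; exact hmem c)
  have hsel : ∀ v : Set.range pat, ∃ c, pat c = v := fun v => v.2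
  choose rep hrep using hsel
  have := hfin.fintype
  refine ⟨Finset.univ.image rep, ?_, fun c => ⟨rep ⟨pat c, c, rfl⟩, by simp, fun q => ?_⟩⟩
  · refine Finset.card_image_le.trans ?_
    rw [Finset.card_univ, ← Set.toFinset_card]
    calc (Set.range pat).toFinset.card
        ≤ (Fintype.piFinset fun _ : Fin m => halfspaceTraces z).card := by
          refine Finset.card_le_card fun v hv => ?_
          rw [Set.mem_toFinset] at hv
          obtain ⟨c, rfl⟩ := hv
          exact hmem c
      _ = (halfspaceTraces z).card ^ m := by
          rw [Fintype.card_piFinset_const]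
      _ ≤ ((Fintype.card α + 1) ^ m) ^ m := Nat.pow_le_pow_left (card_halfspaceTraces_le z) m
      _ = _ := by rw [pow_mul]
  · have hst : ∀ c, StrictMax (M c) j (z q) ↔ ∀ t, t ≠ j → q ∈ pat c t := by
      intro c
      refine forall_congr' fun t => imp_congr_right fun _ => ?_
      simp only [hpat, halfspaceTrace, Finset.mem_filter, Finset.mem_univ, true_and]
      rw [← sub_pos]
      simp only [Matrix.mulVec, dotProduct, Matrix.transpose_apply, ← Finset.sum_sub_distrib,
        sub_mul]
    rw [hst, hst, hrep]

end Growth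

/-! ### First-order optimality of the empirical dual problem -/

open Filter Topology in
/-- The right derivative of a maximum of finitely many affine functions is attained by a maximizer. -/
lemma exists_argmax_eventually_iSup_eq {m : ℕ} (hm : 0 < m) (a b : Fin m → ℝ) :
    ∃ y, (∀ j, a j ≤ a y) ∧ ∀ᶠ s in 𝓝[>] (0 : ℝ), ⨆ j, (a j + s * b j) = a y + s * b y := by
  have : Nonempty (Fin m) := ⟨⟨0, hm⟩⟩
  obtain ⟨y₀, hy₀⟩ := Finite.exists_max a
  -- Among the maximizers of a, one of largest slope b wins for every s > 0; the remaining indices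
  -- start strictly below and stay below for small s.
  obtain ⟨y, hy, hyb⟩ := (Finset.univ.filter fun y => ∀ j, a j ≤ a y).exists_max_image b
    ⟨y₀, by simpa using hy₀⟩
  simp only [Finset.mem_filter, Finset.mem_univ, true_and] at hy hyb
  refine ⟨y, hy, ?_⟩
  have hall : ∀ᶠ s in 𝓝[>] (0 : ℝ), ∀ j, a j + s * b j ≤ a y + s * b y := by
    rw [eventually_all]
    intro j
    rcases (hy j).eq_or_lt with h | h
    · have hb : b j ≤ b y := hyb j fun i => h ▸ hy i
      filter_upwards [self_mem_nhdsWithin] with s hs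
      have hs' : (0 : ℝ) < s := hs
      rw [h]
      nlinarith
    · have hc : Continuous fun s : ℝ => (a y + s * b y) - (a j + s * b j) := by fun_prop
      have h0 : ∀ᶠ s in 𝓝 (0 : ℝ), 0 < (a y + s * b y) - (a j + s * b j) :=
        hc.continuousAt.eventually (lt_mem_nhds (by simpa using h))
      filter_upwards [nhdsWithin_le_nhds h0] with s hs
      linarith
  filter_upwards [hall] with s hs
  exact le_antisymm (ciSup_le hs) (le_ciSup (f := fun j => a j + s * b j)
    (Set.finite_range _).bddAbove y)

section Optimality

variable {𝒳 𝒜 : Type*} {m N n : ℕ} [Fintype 𝒜] [DecidableEq 𝒜]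
  {Ug : Type*} [Fintype Ug] {Ul : Fin N → Type*} [∀ k, Fintype (Ul k)]
  {s : Fin N → Fin n → 𝒳 × 𝒜 × Fin m} {ηhat : 𝒳 → 𝒜 → Fin N → Fin m → ℝ}
  {ξg : ℝ} {ξl : Fin N → ℝ} {phat : 𝒜 → Fin N → ℝ}
  {Dg : Ug → 𝒜 → Fin N → Matrix (Fin m) (Fin m) ℝ}
  {Dl : (k : Fin N) → Ul k → 𝒜 → Matrix (Fin m) (Fin m) ℝ} {θ : Dual Ug Ul}

/-- The penalty part of the dual objective. -/
def penalty (ξg : ℝ) (ξl : Fin N → ℝ) (θ : Dual Ug Ul) : ℝ :=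
  ξg * ∑ u, (θ.lam₁ u + θ.lam₂ u) + ∑ k, ξl k * ∑ u, (θ.mu₁ k u + θ.mu₂ k u)

open Filter Topology in
/-- First-order optimality along a ray of dual parameters. -/
lemma exists_selection_of_ray (hm : 0 < m) (hopt : IsEmpOptimal s ηhat ξg ξl phat Dg Dl θ)
    (W : 𝒜 → Fin N → Matrix (Fin m) (Fin m) ℝ) (ξ : ℝ) (θ' : ℝ → Dual Ug Ul)
    (hnn : ∀ r, 0 < r → (θ' r).Nonneg)
    (hcal : ∀ r a k, calib phat Dg Dl (θ' r) a k = calib phat Dg Dl θ a k + r • W a k)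
    (hpen : ∀ r, penalty ξg ξl (θ' r) = penalty ξg ξl θ + r * ξ) :
    ∃ Y : Fin N → 𝒜 → Fin n → Fin m,
      (∀ k a i, WeakMax (calib phat Dg Dl θ a k) (Y k a i) (ηhat (s k i).1 a k)) ∧
      0 ≤ ∑ k, ∑ a, phat a k * ((1 / ((groupIdx s a k).card : ℝ)) *
        ∑ i ∈ groupIdx s a k, ((W a k).transpose.mulVec (ηhat (s k i).1 a k)) (Y k a i)) + ξ := by
  choose Y hY hYs using fun k a i => exists_argmax_eventually_iSup_eq hm
    ((calib phat Dg Dl θ a k).transpose.mulVec (ηhat (s k i).1 a k))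
    ((W a k).transpose.mulVec (ηhat (s k i).1 a k))
  refine ⟨Y, hY, ?_⟩
  -- Finitely many maxima share one step r at which each is affine along its selected label, so the
  -- objective changes by exactly r times its one-sided derivative.
  have hev := eventually_all.2 fun k => eventually_all.2 fun a => eventually_all.2 fun i =>
    hYs k a i
  obtain ⟨r, hr, hr0⟩ := (hev.and self_mem_nhdsWithin).exists
  have hr0 : 0 < r := hr0
  have hle := hopt.2 (θ' r) (hnn r hr0)
  have hbase : ∀ k a i, ⨆ y, score (calib phat Dg Dl θ) ηhat (s k i).1 a k y =
      ((calib phat Dg Dl θ a k).transpose.mulVec (ηhat (s k i).1 a k)) (Y k a i) := by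
    intro k a i
    have : Nonempty (Fin m) := ⟨⟨0, hm⟩⟩
    exact le_antisymm (ciSup_le (hY k a i)) (le_ciSup
      (f := fun y => score (calib phat Dg Dl θ) ηhat (s k i).1 a k y)
      (Set.finite_range _).bddAbove _)
  have hray : ∀ k a i, ⨆ y, score (calib phat Dg Dl (θ' r)) ηhat (s k i).1 a k y =
      ((calib phat Dg Dl θ a k).transpose.mulVec (ηhat (s k i).1 a k)) (Y k a i) +
      r * ((W a k).transpose.mulVec (ηhat (s k i).1 a k)) (Y k a i) := by
    intro k a i
    rw [← hr k a i]
    refine iSup_congr fun y => ?_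
    rw [score, hcal, Matrix.transpose_add, Matrix.transpose_smul, Matrix.add_mulVec,
      Matrix.smul_mulVec]
    rfl
  have e1 : ∀ θ : Dual Ug Ul, empDual s ηhat ξg ξl phat Dg Dl θ =
      ∑ k, ∑ a, phat a k * ((1 / ((groupIdx s a k).card : ℝ)) *
      ∑ i ∈ groupIdx s a k, ⨆ y, score (calib phat Dg Dl θ) ηhat (s k i).1 a k y) +
      penalty ξg ξl θ := fun θ => add_assoc _ _ _
  rw [e1, e1, hpen] at hle
  simp_rw [hbase, hray, Finset.sum_add_distrib, mul_add, Finset.sum_add_distrib,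
    ← Finset.mul_sum] at hle
  have e2 : ∑ k, ∑ a, phat a k * ((1 / ((groupIdx s a k).card : ℝ)) * (r *
        ∑ i ∈ groupIdx s a k, ((W a k).transpose.mulVec (ηhat (s k i).1 a k)) (Y k a i))) =
      r * ∑ k, ∑ a, phat a k * ((1 / ((groupIdx s a k).card : ℝ)) *
        ∑ i ∈ groupIdx s a k, ((W a k).transpose.mulVec (ηhat (s k i).1 a k)) (Y k a i)) := by
    simp_rw [Finset.mul_sum]
    refine Finset.sum_congr rfl fun k _ => Finset.sum_congr rfl fun a _ =>
      Finset.sum_congr rfl fun i _ => by ring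
  rw [e2] at hle
  by_contra! hneg
  nlinarith

/-- First-order optimality for a direction that changes only the clients in `κ`. -/
lemma exists_selection_of_direction (hm : 0 < m) (hp : ∀ a k, 0 < phat a k)
    (hopt : IsEmpOptimal s ηhat ξg ξl phat Dg Dl θ) (κ : Finset (Fin N))
    (D : 𝒜 → Fin N → Matrix (Fin m) (Fin m) ℝ) (ξ e : ℝ) (θ' : ℝ → Dual Ug Ul)
    (hnn : ∀ r, 0 < r → (θ' r).Nonneg)
    (hcal : ∀ r a k, calib phat Dg Dl (θ' r) a k = calib phat Dg Dl θ a k +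
      r • (if k ∈ κ then (-(e / phat a k)) • D a k else 0))
    (hpen : ∀ r, penalty ξg ξl (θ' r) = penalty ξg ξl θ + r * ξ) :
    ∃ Y : Fin N → 𝒜 → Fin n → Fin m,
      (∀ k a i, WeakMax (calib phat Dg Dl θ a k) (Y k a i) (ηhat (s k i).1 a k)) ∧
      e * ∑ a, ∑ k ∈ κ, (1 / ((groupIdx s a k).card : ℝ)) *
        ∑ i ∈ groupIdx s a k, ((D a k).transpose.mulVec (ηhat (s k i).1 a k)) (Y k a i) ≤ ξ := by
  obtain ⟨Y, hY, h⟩ := exists_selection_of_ray hm hopt _ ξ θ' hnn hcal hpen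
  refine ⟨Y, hY, ?_⟩
  -- The weight `phat` of a group cancels the factor 1 / `phat` of its calibration matrix, so no
  -- accuracy of `phat` is needed.
  have e1 : ∀ k a, phat a k * ((1 / ((groupIdx s a k).card : ℝ)) *
        ∑ i ∈ groupIdx s a k, (Matrix.mulVec (Matrix.transpose
          (if k ∈ κ then (-(e / phat a k)) • D a k else 0)) (ηhat (s k i).1 a k)) (Y k a i)) =
      if k ∈ κ then -(e * ((1 / ((groupIdx s a k).card : ℝ)) *
        ∑ i ∈ groupIdx s a k, ((D a k).transpose.mulVec (ηhat (s k i).1 a k)) (Y k a i)))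
        else 0 := by
    intro k a
    have := (hp a k).ne'
    split_ifs with hk
    · simp only [Matrix.transpose_smul, Matrix.smul_mulVec, Pi.smul_apply, smul_eq_mul,
        ← Finset.mul_sum]
      field_simp
    · simp
  simp_rw [e1] at h
  rw [Finset.sum_comm] at h
  simp_rw [← Finset.sum_filter, Finset.filter_mem_eq_inter, Finset.univ_inter,
    Finset.sum_neg_distrib, ← Finset.mul_sum] at h
  linarith

/-- First-order optimality in the direction of a global multiplier. -/
lemma exists_selection_global (hm : 0 < m) (hp : ∀ a k, 0 < phat a k)
    (hopt : IsEmpOptimal s ηhat ξg ξl phat Dg Dl θ) (u : Ug) (e : ℝ) (he : e = 1 ∨ e = -1) :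
    ∃ Y : Fin N → 𝒜 → Fin n → Fin m,
      (∀ k a i, WeakMax (calib phat Dg Dl θ a k) (Y k a i) (ηhat (s k i).1 a k)) ∧
      e * ∑ a, ∑ k ∈ Finset.univ, (1 / ((groupIdx s a k).card : ℝ)) *
        ∑ i ∈ groupIdx s a k, ((Dg u a k).transpose.mulVec (ηhat (s k i).1 a k)) (Y k a i)
        ≤ ξg := by
  classical
  obtain ⟨h1, h2, h3, h4⟩ := hopt.1
  have hs : ∀ r : ℝ, 0 < r → ∀ v, 0 ≤ (Pi.single u r : Ug → ℝ) v := fun r hr v => by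
    rw [Pi.single_apply]; split_ifs <;> linarith
  have hD : ∀ (r : ℝ) a k, ∑ v, (Pi.single u r : Ug → ℝ) v • Dg v a k = r • Dg u a k := by
    intro r a k
    rw [Fintype.sum_eq_single u fun v hv => by rw [Pi.single_eq_of_ne hv, zero_smul],
      Pi.single_eq_same]
  have hS : ∀ r : ℝ, ∑ v, (Pi.single u r : Ug → ℝ) v = r := fun r => by
    rw [Fintype.sum_eq_single u fun v hv => by rw [Pi.single_eq_of_ne hv], Pi.single_eq_same]
  -- Sign +1 comes from increasing `lam₁`, sign -1 from increasing `lam₂`; each costs ξg per unit.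
  rcases he with rfl | rfl
  · refine exists_selection_of_direction hm hp hopt Finset.univ (Dg u) ξg 1
      (fun r => { θ with lam₁ := θ.lam₁ + Pi.single u r })
      (fun r hr => ⟨fun v => add_nonneg (h1 v) (hs r hr v), h2, h3, h4⟩) (fun r a k => ?_)
      (fun r => ?_)
    · simp only [calib, Pi.add_apply, Finset.mem_univ, if_true]
      have : ∀ v, (θ.lam₁ v + (Pi.single u r : Ug → ℝ) v - θ.lam₂ v) • Dg v a k =
          (θ.lam₁ v - θ.lam₂ v) • Dg v a k + (Pi.single u r : Ug → ℝ) v • Dg v a k := fun v => by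
        module
      simp_rw [this, Finset.sum_add_distrib, hD]
      module
    · simp only [penalty, Pi.add_apply, Finset.sum_add_distrib, hS]
      ring
  · refine exists_selection_of_direction hm hp hopt Finset.univ (Dg u) ξg (-1)
      (fun r => { θ with lam₂ := θ.lam₂ + Pi.single u r })
      (fun r hr => ⟨h1, fun v => add_nonneg (h2 v) (hs r hr v), h3, h4⟩) (fun r a k => ?_)
      (fun r => ?_)
    · simp only [calib, Pi.add_apply, Finset.mem_univ, if_true]
      have : ∀ v, (θ.lam₁ v - (θ.lam₂ v + (Pi.single u r : Ug → ℝ) v)) • Dg v a k =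
          (θ.lam₁ v - θ.lam₂ v) • Dg v a k - (Pi.single u r : Ug → ℝ) v • Dg v a k := fun v => by
        module
      simp_rw [this, Finset.sum_sub_distrib, hD]
      module
    · simp only [penalty, Pi.add_apply, Finset.sum_add_distrib, hS]
      ring

/-- First-order optimality in the direction of a local multiplier. -/
lemma exists_selection_local (hm : 0 < m) (hp : ∀ a k, 0 < phat a k)
    (hopt : IsEmpOptimal s ηhat ξg ξl phat Dg Dl θ) (k : Fin N) (u : Ul k) (e : ℝ)
    (he : e = 1 ∨ e = -1) :
    ∃ Y : Fin N → 𝒜 → Fin n → Fin m,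
      (∀ k a i, WeakMax (calib phat Dg Dl θ a k) (Y k a i) (ηhat (s k i).1 a k)) ∧
      e * ∑ a, ∑ k' ∈ {k}, (1 / ((groupIdx s a k').card : ℝ)) *
        ∑ i ∈ groupIdx s a k', ((Dl k u a).transpose.mulVec (ηhat (s k' i).1 a k')) (Y k' a i)
        ≤ ξl k := by
  classical
  obtain ⟨h1, h2, h3, h4⟩ := hopt.1
  set δ : ℝ → (k' : Fin N) → Ul k' → ℝ := fun r => Pi.single k (Pi.single u r) with hδ
  have hs : ∀ r : ℝ, 0 < r → ∀ k' v, 0 ≤ δ r k' v := fun r hr k' v => by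
    by_cases hk : k' = k
    · subst hk
      simp only [hδ, Pi.single_eq_same]
      rw [Pi.single_apply]; split_ifs <;> linarith
    · simp [hδ, hk]
  have hD : ∀ (r : ℝ) a k', ∑ v, δ r k' v • Dl k' v a = if k' ∈ ({k} : Finset (Fin N)) then
      r • Dl k u a else 0 := by
    intro r a k'
    by_cases hk : k' = k
    · subst hk
      simp only [hδ, Pi.single_eq_same, Finset.mem_singleton, if_true]
      rw [Fintype.sum_eq_single u fun v hv => by rw [Pi.single_eq_of_ne hv, zero_smul],
        Pi.single_eq_same]
    · simp [hδ, hk]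
  have hS : ∀ r : ℝ, ∑ k', ξl k' * ∑ v, δ r k' v = r * ξl k := fun r => by
    rw [Fintype.sum_eq_single k fun k' hk => by simp [hδ, Pi.single_eq_of_ne hk]]
    simp only [hδ, Pi.single_eq_same]
    rw [Fintype.sum_eq_single u fun v hv => by rw [Pi.single_eq_of_ne hv], Pi.single_eq_same,
      mul_comm]
  -- The local multipliers enter the calibration matrix with the opposite sign, so here +1 comes
  -- from `mu₂` and -1 from `mu₁`.
  rcases he with rfl | rfl
  · refine exists_selection_of_direction hm hp hopt {k} (fun a _ => Dl k u a) (ξl k) 1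
      (fun r => { θ with mu₂ := θ.mu₂ + δ r })
      (fun r hr => ⟨h1, h2, h3, fun k v => add_nonneg (h4 k v) (hs r hr k v)⟩) (fun r a k' => ?_)
      (fun r => ?_)
    · simp only [calib, Pi.add_apply]
      have : ∀ v, (θ.mu₁ k' v - (θ.mu₂ k' v + δ r k' v)) • Dl k' v a =
          (θ.mu₁ k' v - θ.mu₂ k' v) • Dl k' v a - δ r k' v • Dl k' v a := fun v => by
        module
      simp_rw [this, Finset.sum_sub_distrib, hD]
      split_ifs <;> module
    · simp only [penalty, Pi.add_apply, Finset.sum_add_distrib, mul_add, hS]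
      ring
  · refine exists_selection_of_direction hm hp hopt {k} (fun a _ => Dl k u a) (ξl k) (-1)
      (fun r => { θ with mu₁ := θ.mu₁ + δ r })
      (fun r hr => ⟨h1, h2, fun k v => add_nonneg (h3 k v) (hs r hr k v), h4⟩) (fun r a k' => ?_)
      (fun r => ?_)
    · simp only [calib, Pi.add_apply]
      have : ∀ v, (θ.mu₁ k' v + δ r k' v - θ.mu₂ k' v) • Dl k' v a =
          (θ.mu₁ k' v - θ.mu₂ k' v) • Dl k' v a + δ r k' v • Dl k' v a := fun v => by
        module
      simp_rw [this, Finset.sum_add_distrib, hD]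
      split_ifs <;> module
    · simp only [penalty, Pi.add_apply, Finset.sum_add_distrib, mul_add, hS]
      ring

end Optimality

/-! ### The population side -/

/-- A hyperplane through the origin meets the simplex in a set of dimension less than `m - 1`. -/
lemma hausdorffMeasure_hyperplane_inter_stdSimplex {m : ℕ} (v : Fin m → ℝ) (hv : v ≠ 0) :
    Measure.hausdorffMeasure ((m : ℝ) - 1) ({x | v ⬝ᵥ x = 0} ∩ stdSimplex ℝ (Fin m)) = 0 := by
  set K : Set (Fin m → ℝ) := {x | v ⬝ᵥ x = 0} ∩ stdSimplex ℝ (Fin m) with hK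
  rcases K.eq_empty_or_nonempty with h | ⟨x₀, hx₀⟩
  · rw [h, measure_empty]
  set f : (Fin m → ℝ) →ₗ[ℝ] ℝ := dotProductBilin ℝ ℝ v with hf
  set g : (Fin m → ℝ) →ₗ[ℝ] ℝ := dotProductBilin ℝ ℝ (1 : Fin m → ℝ) with hg
  have hgv : ∀ x, g x = ∑ i, x i := fun x => by
    change (1 : Fin m → ℝ) ⬝ᵥ x = _
    simp [dotProduct]
  have hconv : Convex ℝ K := by
    refine Convex.inter ?_ (convex_stdSimplex ℝ _)
    exact (LinearMap.ker f).convex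
  have hspan : vectorSpan ℝ K ≤ LinearMap.ker f ⊓ LinearMap.ker g := by
    rw [vectorSpan, Submodule.span_le]
    rintro _ ⟨x, hx, y, hy, rfl⟩
    have h1 : f x = 0 := hx.1
    have h2 : f y = 0 := hy.1
    have h3 : g x = 1 := (hgv x).trans hx.2.2
    have h4 : g y = 1 := (hgv y).trans hy.2.2
    simp [h1, h2, h3, h4]
  -- The point x₀ lies in ker f but has coordinate sum 1, so the second functional really drops the
  -- dimension: the affine span of K has dimension at most m - 2.
  have hlt1 : LinearMap.ker f ⊓ LinearMap.ker g < LinearMap.ker f := by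
    refine lt_of_le_of_ne inf_le_left fun h => ?_
    have h1 : x₀ ∈ LinearMap.ker f := hx₀.1
    rw [← h] at h1
    have h2 : g x₀ = 0 := h1.2
    rw [hgv, hx₀.2.2] at h2
    exact one_ne_zero h2
  have hlt2 : LinearMap.ker f < ⊤ := by
    refine lt_top_iff_ne_top.2 fun h => hv ?_
    have : f v = 0 := by
      have : v ∈ LinearMap.ker f := h ▸ Submodule.mem_top
      exact this
    exact dotProduct_self_eq_zero.1 this
  have hr1 := Submodule.finrank_mono hspan
  have hr2 := Submodule.finrank_lt_finrank_of_lt hlt1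
  have hr3 := Submodule.finrank_lt_finrank_of_lt hlt2
  rw [finrank_top, Module.finrank_fin_fun] at hr3
  have hd : ((m : ℝ) - 1) = (((m - 1 : ℕ) : NNReal) : ℝ) := by
    rw [NNReal.coe_natCast, Nat.cast_sub (by omega)]; simp
  rw [hd]
  refine hausdorffMeasure_of_dimH_lt ?_
  rw [Real.Convex.dimH_eq_finrank_vectorSpan hconv ⟨x₀, hx₀⟩]
  have : Module.finrank ℝ (vectorSpan ℝ K) < m - 1 := by omega
  exact_mod_cast this

section Population

variable {𝒳 𝒜 : Type*} [MeasurableSpace 𝒳] [MeasurableSpace 𝒜] [MeasurableSingletonClass 𝒜]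
  {m N : ℕ} (P : Measure (𝒳 × 𝒜 × Fin m × Fin N)) [IsProbabilityMeasure P]

lemma measurableSet_attr (a : 𝒜) : MeasurableSet {z : 𝒳 × 𝒜 × Fin m × Fin N | z.2.1 = a} :=
  (measurable_fst.comp measurable_snd) (measurableSet_singleton a)

omit [MeasurableSingletonClass 𝒜] in
lemma measurableSet_clientSet (k : Fin N) : MeasurableSet (clientSet 𝒳 𝒜 m k) :=
  (measurable_snd.comp (measurable_snd.comp measurable_snd)) (measurableSet_singleton k)

lemma measurableSet_groupSet (a : 𝒜) (k : Fin N) : MeasurableSet (groupSet 𝒳 m a k) :=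
  (measurableSet_attr a).inter (measurableSet_clientSet k)

omit [MeasurableSingletonClass 𝒜] in
lemma measurableSet_label (i : Fin m) :
    MeasurableSet {z : 𝒳 × 𝒜 × Fin m × Fin N | z.2.2.1 = i} :=
  (measurable_fst.comp (measurable_snd.comp measurable_snd)) (measurableSet_singleton i)

omit [MeasurableSingletonClass 𝒜] [IsProbabilityMeasure P] in
/-- Ties have probability zero. -/
lemma ae_no_ties {ηhat : 𝒳 → 𝒜 → Fin N → Fin m → ℝ} (hη : IsContinuousScore P ηhat)
    {M : 𝒜 → Fin N → Matrix (Fin m) (Fin m) ℝ} (hM : Nonsingular M) (a : 𝒜) (k : Fin N) :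
    ∀ᵐ z ∂(cond P (groupSet 𝒳 m a k)), ∀ t j, t ≠ j →
      ((M a k).transpose.mulVec (ηhat z.1 a k)) t ≠
        ((M a k).transpose.mulVec (ηhat z.1 a k)) j := by
  rw [ae_all_iff]; intro t
  rw [ae_all_iff]; intro j
  by_cases htj : t = j
  · exact ae_of_all _ fun z h => absurd htj h
  -- A tie between t and j puts the score on the hyperplane normal to the difference of two columns,
  -- which is non-zero by nonsingularity.
  set v : Fin m → ℝ := fun i => M a k i t - M a k i j with hv
  have hv0 : v ≠ 0 := by
    intro h
    refine hM a k t j htj (funext fun i => ?_)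
    exact sub_eq_zero.1 (congrFun h i)
  have hclosed : IsClosed {x : Fin m → ℝ | v ⬝ᵥ x = 0} :=
    isClosed_eq (by unfold dotProduct; fun_prop) continuous_const
  have hnull : ((cond P (groupSet 𝒳 m a k)).map (fun z => ηhat z.1 a k))
      {x | v ⬝ᵥ x = 0} = 0 := by
    refine hη.absolutelyContinuous a k ?_
    rw [Measure.restrict_apply hclosed.measurableSet]
    exact hausdorffMeasure_hyperplane_inter_stdSimplex v hv0
  have hae : ∀ᵐ x ∂((cond P (groupSet 𝒳 m a k)).map (fun z => ηhat z.1 a k)),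
      ¬ v ⬝ᵥ x = 0 := by
    rw [ae_iff]; simpa using hnull
  have hmeas : Measurable fun z : 𝒳 × 𝒜 × Fin m × Fin N => ηhat z.1 a k :=
    (hη.measurable a k).comp measurable_fst
  filter_upwards [ae_of_ae_map hmeas.aemeasurable hae] with z hz _ heq
  refine hz ?_
  rw [← sub_eq_zero] at heq
  rw [← heq]
  simp only [hv, Matrix.mulVec, dotProduct, Matrix.transpose_apply, ← Finset.sum_sub_distrib,
    sub_mul]

omit [MeasurableSingletonClass 𝒜] in
/-- `E[1{Y = i} φ(X) | A = a, K = k] = E[η_i(X,a,k) φ(X) | A = a, K = k]`. -/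
lemma integral_label_eq {η : 𝒳 → 𝒜 → Fin N → Fin m → ℝ} (hη : IsBayesScore P η)
    (a : 𝒜) (k : Fin N) (i : Fin m) (φ : 𝒳 → ℝ) (hφ : Measurable φ) :
    ∫ z, (if z.2.2.1 = i then φ z.1 else 0) ∂(cond P (groupSet 𝒳 m a k)) =
      ∫ z, η z.1 a k i * φ z.1 ∂(cond P (groupSet 𝒳 m a k)) := by
  have hηm : Measurable fun x => η x a k i := (measurable_pi_apply i).comp (hη.measurable a k)
  have hnn : ∀ x, 0 ≤ η x a k i := fun x => (hη.mem_simplex x a k).1 i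
  have hle : ∀ x, η x a k i ≤ 1 := fun x => by
    rw [← (hη.mem_simplex x a k).2]
    exact Finset.single_le_sum (fun j _ => (hη.mem_simplex x a k).1 j) (Finset.mem_univ i)
  set gS := groupSet 𝒳 m a k with hgS
  set lS : Set (𝒳 × 𝒜 × Fin m × Fin N) := {z | z.2.2.1 = i} with hlS
  -- On the group, the law of X restricted to label i has density η_i. As an identity of measures it
  -- applies to every measurable φ, without any integrability.
  have hmeq : (P.restrict (gS ∩ lS)).map Prod.fst =
      ((P.restrict gS).map Prod.fst).withDensity fun x => ENNReal.ofReal (η x a k i) := by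
    ext s hs
    have hpre : MeasurableSet (Prod.fst ⁻¹' s : Set (𝒳 × 𝒜 × Fin m × Fin N)) :=
      measurable_fst hs
    rw [Measure.map_apply measurable_fst hs, Measure.restrict_apply hpre,
      withDensity_apply _ hs, setLIntegral_map hs hηm.ennreal_ofReal measurable_fst,
      Measure.restrict_restrict hpre]
    have h1 := hη.setIntegral_eq a k i s hs
    have hint : Integrable (fun z : 𝒳 × 𝒜 × Fin m × Fin N => η z.1 a k i)
        (P.restrict (Prod.fst ⁻¹' s ∩ gS)) :=
      Integrable.of_bound (hηm.comp measurable_fst).aestronglyMeasurable 1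
        (ae_of_all _ fun z => by rw [Real.norm_eq_abs, abs_of_nonneg (hnn _)]; exact hle _)
    rw [← ofReal_integral_eq_lintegral_ofReal hint (ae_of_all _ fun z => hnn _)]
    have h2 : ∫ z in Prod.fst ⁻¹' s ∩ gS, η z.1 a k i ∂P = P.real (Prod.fst ⁻¹' s ∩ (gS ∩ lS)) := by
      refine h1.trans (congrArg P.real ?_)
      ext z
      simp only [Set.mem_ofPred_eq, Set.mem_inter_iff, Set.mem_preimage, hgS, hlS, groupSet]
      tauto
    rw [h2, ofReal_measureReal]
  have hkey : ∫ z in gS ∩ lS, φ z.1 ∂P = ∫ z in gS, η z.1 a k i * φ z.1 ∂P := by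
    rw [← integral_map (φ := Prod.fst) (f := φ) measurable_fst.aemeasurable
      hφ.aestronglyMeasurable, hmeq,
      integral_withDensity_eq_integral_toReal_smul hηm.ennreal_ofReal
        (ae_of_all _ fun _ => ENNReal.ofReal_lt_top),
      integral_map measurable_fst.aemeasurable
        (hηm.ennreal_ofReal.ennreal_toReal.fun_smul hφ).aestronglyMeasurable]
    refine integral_congr_ae (ae_of_all _ fun z => ?_)
    simp only [smul_eq_mul, ENNReal.toReal_ofReal (hnn _)]
  have hind : ∫ z in gS, (if z.2.2.1 = i then φ z.1 else 0) ∂P = ∫ z in gS ∩ lS, φ z.1 ∂P := by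
    rw [← setIntegral_indicator (measurableSet_label i)]
    refine integral_congr_ae (ae_of_all _ fun z => ?_)
    simp [Set.indicator_apply]
  rw [ProbabilityTheory.cond, integral_smul_measure, integral_smul_measure, hind, hkey]

/-- The confusion matrix in terms of the Bayes score. -/
lemma confusion_eq {η : 𝒳 → 𝒜 → Fin N → Fin m → ℝ} (hη : IsBayesScore P η)
    (h : 𝒳 → 𝒜 → Fin m → ℝ) (a : 𝒜) (k : Fin N) (hh : Measurable fun x => h x a) (i j : Fin m) :
    confusion P h a k i j =
      ∫ z, η z.1 a k i * h z.1 a j ∂(cond P (groupSet 𝒳 m a k)) := by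
  rw [← integral_label_eq P hη a k i (fun x => h x a j) ((measurable_pi_apply j).comp hh), confusion]
  refine integral_congr_ae ?_
  filter_upwards [ae_cond_mem (measurableSet_groupSet a k)] with z hz
  have : z.2.1 = a := hz.1
  simp only [this]

/-- Expectations over a group in terms of the local distribution of the client. -/
lemma integral_localLaw_eq (a : 𝒜) [DecidableEq 𝒜] (k : Fin N)
    (hP : 0 < P (groupSet 𝒳 m a k)) (φ : 𝒳 → ℝ) (hφ : Measurable φ) :
    ∫ s, (if s.2.1 = a then φ s.1 else 0) ∂(localLaw P k) =
      groupProb P a k * ∫ z, φ z.1 ∂(cond P (groupSet 𝒳 m a k)) := by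
  have hm1 : Measurable fun z : 𝒳 × 𝒜 × Fin m × Fin N => (z.1, z.2.1, z.2.2.1) := by fun_prop
  have hm2 : Measurable fun s : 𝒳 × 𝒜 × Fin m => (if s.2.1 = a then φ s.1 else 0) :=
    Measurable.ite ((measurable_fst.comp measurable_snd) (measurableSet_singleton a))
      (hφ.comp measurable_fst) measurable_const
  rw [localLaw, integral_map hm1.aemeasurable hm2.aestronglyMeasurable]
  have hset : clientSet 𝒳 𝒜 m k ∩ {z | z.2.1 = a} = groupSet 𝒳 m a k := by
    ext z; simp only [clientSet, groupSet, Set.mem_inter_iff, Set.mem_ofPred_eq]; tauto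
  have hind : ∫ z in clientSet 𝒳 𝒜 m k, (if z.2.1 = a then φ z.1 else 0) ∂P =
      ∫ z in groupSet 𝒳 m a k, φ z.1 ∂P := by
    rw [← hset, ← setIntegral_indicator (measurableSet_attr a)]
    refine integral_congr_ae (ae_of_all _ fun z => ?_)
    simp [Set.indicator_apply]
  have hp : groupProb P a k = (P (clientSet 𝒳 𝒜 m k))⁻¹.toReal *
      (P (groupSet 𝒳 m a k)).toReal := by
    rw [groupProb, measureReal_def, cond_apply (measurableSet_clientSet k), hset,
      ENNReal.toReal_mul]
  rw [hp, ProbabilityTheory.cond, ProbabilityTheory.cond, integral_smul_measure, integral_smul_measure, hind, smul_eq_mul, smul_eq_mul,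
    ENNReal.toReal_inv (P (groupSet 𝒳 m a k))]
  have h0 : (P (groupSet 𝒳 m a k)).toReal ≠ 0 :=
    (ENNReal.toReal_pos hP.ne' (measure_ne_top _ _)).ne'
  field_simp

end Population

/-! ### Sandwiching a decision region between rational cells -/

section Approximation

open Filter Topology

variable {m : ℕ}

/-- The real matrix with the given rational entries. -/
def ratMatrix (c : Fin m → Fin m → ℚ) : Matrix (Fin m) (Fin m) ℝ := fun i t => (c i t : ℝ)

/-- On the simplex the change of score t is a convex combination of the entry changes in column t,
so even strict bounds pass from entries to scores. -/
lemma mulVec_sub_mem_of_entries {M M' : Matrix (Fin m) (Fin m) ℝ} {t : Fin m} {lo hi : ℝ}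
    (hM : ∀ i, M' i t - M i t ∈ Set.Ioo lo hi) {v : Fin m → ℝ} (hv : v ∈ stdSimplex ℝ (Fin m)) :
    (M'.transpose.mulVec v) t - (M.transpose.mulVec v) t ∈ Set.Ioo lo hi := by
  have e : (M'.transpose.mulVec v) t - (M.transpose.mulVec v) t =
      ∑ i, v i • (M' i t - M i t) := by
    simp only [Matrix.mulVec, dotProduct, Matrix.transpose_apply, ← Finset.sum_sub_distrib,
      smul_eq_mul]
    exact Finset.sum_congr rfl fun i _ => by ring
  rw [e]
  exact (convex_Ioo lo hi).sum_mem (fun i _ => hv.1 i) hv.2 fun i _ => hM i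

/-- Rational matrices converging to `M`, with column `j` approached from above for `e = 1` and
from below for `e = -1`, and the other columns from the opposite side. -/
lemma exists_ratMatrix_tendsto (M : Matrix (Fin m) (Fin m) ℝ) (j : Fin m) (e : ℝ)
    (he : e = 1 ∨ e = -1) :
    ∃ c : ℕ → Fin m → Fin m → ℚ, ∀ v ∈ stdSimplex ℝ (Fin m),
      (∀ t, Tendsto (fun r => ((ratMatrix (c r)).transpose.mulVec v) t) atTop
        (𝓝 ((M.transpose.mulVec v) t))) ∧
      (∀ r, 0 < e * (((ratMatrix (c r)).transpose.mulVec v) j - (M.transpose.mulVec v) j)) ∧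
      ∀ r t, t ≠ j →
        e * (((ratMatrix (c r)).transpose.mulVec v) t - (M.transpose.mulVec v) t) < 0 := by
  -- Density of ℚ gives an entry within 1 / (r + 1) of the real one, strictly on the prescribed
  -- side.
  have hex : ∀ (r : ℕ) (i t : Fin m), ∃ q : ℚ, |(q : ℝ) - M i t| < 1 / ((r : ℝ) + 1) ∧
      (if t = j then 0 < e * ((q : ℝ) - M i t) else e * ((q : ℝ) - M i t) < 0) := by
    intro r i t
    have hr : 0 < 1 / ((r : ℝ) + 1) := by positivity
    obtain ⟨q₁, h1, h2⟩ := exists_rat_btwn (lt_add_of_pos_right (M i t) hr)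
    obtain ⟨q₂, h3, h4⟩ := exists_rat_btwn (sub_lt_self (M i t) hr)
    have hq1 : |(q₁ : ℝ) - M i t| < 1 / ((r : ℝ) + 1) := by rw [abs_lt]; constructor <;> linarith
    have hq2 : |(q₂ : ℝ) - M i t| < 1 / ((r : ℝ) + 1) := by rw [abs_lt]; constructor <;> linarith
    rcases he with rfl | rfl
    · by_cases htj : t = j
      · exact ⟨q₁, hq1, by rw [if_pos htj]; linarith⟩
      · exact ⟨q₂, hq2, by rw [if_neg htj]; linarith⟩
    · by_cases htj : t = j
      · exact ⟨q₂, hq2, by rw [if_pos htj]; linarith⟩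
      · exact ⟨q₁, hq1, by rw [if_neg htj]; linarith⟩
  choose c hc hcs using hex
  refine ⟨c, fun v hv => ⟨fun t => ?_, fun r => ?_, fun r t ht => ?_⟩⟩
  · rw [tendsto_iff_dist_tendsto_zero]
    refine squeeze_zero (fun _ => dist_nonneg) (fun r => ?_) tendsto_one_div_add_atTop_nhds_zero_nat
    have := mulVec_sub_mem_of_entries (M := M) (M' := ratMatrix (c r)) (t := t)
      (fun i => abs_lt.1 (hc r i t)) hv
    rw [Real.dist_eq]
    exact (abs_lt.2 this).le
  · have h1 : ∀ i, 0 < e * (ratMatrix (c r) i j - M i j) := fun i => by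
      have := hcs r i j; rwa [if_pos rfl] at this
    rcases he with rfl | rfl
    · have := mulVec_sub_mem_of_entries (M := M) (M' := ratMatrix (c r)) (t := j) (lo := 0)
        (fun i => ⟨by linarith [h1 i], (abs_lt.1 (hc r i j)).2⟩) hv
      linarith [this.1]
    · have := mulVec_sub_mem_of_entries (M := M) (M' := ratMatrix (c r)) (t := j) (hi := 0)
        (fun i => ⟨(abs_lt.1 (hc r i j)).1, by linarith [h1 i]⟩) hv
      linarith [this.2]
  · have h1 : ∀ i, e * (ratMatrix (c r) i t - M i t) < 0 := fun i => by
      have := hcs r i t; rwa [if_neg ht] at this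
    rcases he with rfl | rfl
    · have := mulVec_sub_mem_of_entries (M := M) (M' := ratMatrix (c r)) (t := t) (hi := 0)
        (fun i => ⟨(abs_lt.1 (hc r i t)).1, by linarith [h1 i]⟩) hv
      linarith [this.2]
    · have := mulVec_sub_mem_of_entries (M := M) (M' := ratMatrix (c r)) (t := t) (lo := 0)
        (fun i => ⟨by linarith [h1 i], (abs_lt.1 (hc r i t)).2⟩) hv
      linarith [this.1]

/-- Approximation of the decision region `j` from outside. -/
lemma exists_outer_approximation (M : Matrix (Fin m) (Fin m) ℝ) (j : Fin m) :
    ∃ c : ℕ → Fin m → Fin m → ℚ, ∀ v ∈ stdSimplex ℝ (Fin m),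
      (WeakMax M j v → ∀ r, StrictMax (ratMatrix (c r)) j v) ∧
      (¬ WeakMax M j v → ∀ᶠ r in atTop, ¬ StrictMax (ratMatrix (c r)) j v) := by
  obtain ⟨c, hc⟩ := exists_ratMatrix_tendsto M j 1 (Or.inl rfl)
  refine ⟨c, fun v hv => ?_⟩
  obtain ⟨h1, h2, h3⟩ := hc v hv
  refine ⟨fun hw r t ht => ?_, fun hw => ?_⟩
  · linarith [h2 r, h3 r t ht, hw t]
  · simp only [WeakMax, not_forall, not_le] at hw
    obtain ⟨t, ht⟩ := hw
    have htj : t ≠ j := by rintro rfl; exact lt_irrefl _ ht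
    filter_upwards [(h1 j).eventually_lt (h1 t) ht] with r hr hs
    exact lt_asymm hr (hs t htj)

/-- Approximation of the decision region `j` from inside. -/
lemma exists_inner_approximation (M : Matrix (Fin m) (Fin m) ℝ) (j : Fin m) :
    ∃ c : ℕ → Fin m → Fin m → ℚ, ∀ v ∈ stdSimplex ℝ (Fin m),
      (StrictMax M j v → ∀ᶠ r in atTop, StrictMax (ratMatrix (c r)) j v) ∧
      (¬ StrictMax M j v → ∀ r, ¬ StrictMax (ratMatrix (c r)) j v) := by
  obtain ⟨c, hc⟩ := exists_ratMatrix_tendsto M j (-1) (Or.inr rfl)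
  refine ⟨c, fun v hv => ?_⟩
  obtain ⟨h1, h2, h3⟩ := hc v hv
  refine ⟨fun hs => ?_, fun hs r hr => hs fun t ht => ?_⟩
  · refine eventually_all.2 fun t => ?_
    by_cases ht : t = j
    · exact Eventually.of_forall fun r h => absurd ht h
    · filter_upwards [(h1 t).eventually_lt (h1 j) (hs t ht)] with r hr _
      exact hr
  · linarith [h2 r, h3 r t ht, hr t ht]

end Approximation

/-! ### Empirical confusion matrices -/

section Empirical

open Filter Topology

variable {𝒳 𝒜 : Type*} [MeasurableSpace 𝒳] [MeasurableSpace 𝒜] [MeasurableSingletonClass 𝒜]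
  [DecidableEq 𝒜] {m N n : ℕ}

open Classical in
/-- The `i`-th score on the open decision region `j` of `M`, and zero elsewhere. -/
noncomputable def cellScore (ηhat : 𝒳 → 𝒜 → Fin N → Fin m → ℝ) (a : 𝒜) (k : Fin N) (i j : Fin m)
    (M : Matrix (Fin m) (Fin m) ℝ) (x : 𝒳) : ℝ :=
  if StrictMax M j (ηhat x a k) then ηhat x a k i else 0

/-- `cellScore` on group `a`, as a function on the sample space of client `k`. -/
noncomputable def cellFn (ηhat : 𝒳 → 𝒜 → Fin N → Fin m → ℝ) (a : 𝒜) (k : Fin N) (i j : Fin m)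
    (M : Matrix (Fin m) (Fin m) ℝ) (s : 𝒳 × 𝒜 × Fin m) : ℝ :=
  if s.2.1 = a then cellScore ηhat a k i j M s.1 else 0

lemma le_one_of_mem_stdSimplex {v : Fin m → ℝ} (hv : v ∈ stdSimplex ℝ (Fin m)) (i : Fin m) :
    v i ≤ 1 := by
  rw [← hv.2]
  exact Finset.single_le_sum (fun j _ => hv.1 j) (Finset.mem_univ i)

lemma measurableSet_strictMax (M : Matrix (Fin m) (Fin m) ℝ) (j : Fin m) :
    MeasurableSet {v | StrictMax M j v} := by
  have hm : ∀ t, Measurable fun v : Fin m → ℝ => (M.transpose.mulVec v) t := fun t => by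
    unfold Matrix.mulVec dotProduct; fun_prop
  have : {v | StrictMax M j v} = ⋂ t, {v | t ≠ j → (M.transpose.mulVec v) t <
      (M.transpose.mulVec v) j} := by ext; simp [StrictMax]
  rw [this]
  refine MeasurableSet.iInter fun t => ?_
  by_cases ht : t = j
  · simp [ht]
  · simpa [ht] using measurableSet_lt (hm t) (hm j)

variable {P : Measure (𝒳 × 𝒜 × Fin m × Fin N)} [IsProbabilityMeasure P]
  {ηhat : 𝒳 → 𝒜 → Fin N → Fin m → ℝ}

omit [MeasurableSingletonClass 𝒜] [DecidableEq 𝒜] [IsProbabilityMeasure P] in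
lemma measurable_cellScore (hη : IsContinuousScore P ηhat) (a : 𝒜) (k : Fin N) (i j : Fin m)
    (M : Matrix (Fin m) (Fin m) ℝ) : Measurable (cellScore ηhat a k i j M) :=
  Measurable.ite (hη.measurable a k (measurableSet_strictMax M j))
    ((measurable_pi_apply i).comp (hη.measurable a k)) measurable_const

omit [IsProbabilityMeasure P] in
lemma measurable_cellFn (hη : IsContinuousScore P ηhat) (a : 𝒜) (k : Fin N) (i j : Fin m)
    (M : Matrix (Fin m) (Fin m) ℝ) : Measurable (cellFn ηhat a k i j M) :=
  Measurable.ite ((measurable_fst.comp measurable_snd) (measurableSet_singleton a))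
    ((measurable_cellScore hη a k i j M).comp measurable_fst) measurable_const

omit [MeasurableSingletonClass 𝒜] [DecidableEq 𝒜] [IsProbabilityMeasure P] in
lemma cellScore_mem_Icc (hη : IsContinuousScore P ηhat) (a : 𝒜) (k : Fin N) (i j : Fin m)
    (M : Matrix (Fin m) (Fin m) ℝ) (x : 𝒳) : cellScore ηhat a k i j M x ∈ Set.Icc (0 : ℝ) 1 := by
  unfold cellScore
  split_ifs
  · exact ⟨(hη.mem_simplex x a k).1 i, le_one_of_mem_stdSimplex (hη.mem_simplex x a k) i⟩
  · exact ⟨le_rfl, zero_le_one⟩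

omit [MeasurableSingletonClass 𝒜] [IsProbabilityMeasure P] in
lemma cellFn_mem_Icc (hη : IsContinuousScore P ηhat) (a : 𝒜) (k : Fin N) (i j : Fin m)
    (M : Matrix (Fin m) (Fin m) ℝ) (s : 𝒳 × 𝒜 × Fin m) :
    cellFn ηhat a k i j M s ∈ Set.Icc (0 : ℝ) 1 := by
  unfold cellFn
  split_ifs
  · exact cellScore_mem_Icc hη a k i j M s.1
  · exact ⟨le_rfl, zero_le_one⟩

variable (P ηhat) in
/-- The samples of the clients in `κ` are representative up to `t`. -/
def Representative (κ : Finset (Fin N)) (t : ℝ) (s : Fin N → Fin n → 𝒳 × 𝒜 × Fin m) : Prop :=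
  ∀ k ∈ κ, ∀ a,
    |∑ l, (if (s k l).2.1 = a then (1 : ℝ) else 0) - n * groupProb P a k| ≤ n * t ∧
    ∀ (i j : Fin m) (c : Fin m → Fin m → ℚ),
      |∑ l, cellFn ηhat a k i j (ratMatrix c) (s k l) -
        n * ∫ y, cellFn ηhat a k i j (ratMatrix c) y ∂(localLaw P k)| ≤ n * t

/-- The empirical confusion matrix of a selection of labels, with the true label distribution
replaced by the score. -/
noncomputable def empConfusion (s : Fin N → Fin n → 𝒳 × 𝒜 × Fin m)
    (ηhat : 𝒳 → 𝒜 → Fin N → Fin m → ℝ) (Y : Fin n → Fin m) (a : 𝒜) (k : Fin N) :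
    Matrix (Fin m) (Fin m) ℝ :=
  fun i j => 1 / ((groupIdx s a k).card : ℝ) *
    ∑ l ∈ groupIdx s a k, if Y l = j then ηhat (s k l).1 a k i else 0

omit [MeasurableSingletonClass 𝒜] [DecidableEq 𝒜] [IsProbabilityMeasure P] in
/-- Convergence of cell expectations to the expected score of a plug-in classifier. -/
lemma tendsto_integral_cellScore (hη : IsContinuousScore P ηhat)
    {M : 𝒜 → Fin N → Matrix (Fin m) (Fin m) ℝ} (hM : Nonsingular M)
    {h : Fin N → 𝒳 → 𝒜 → Fin m → ℝ} (hh : IsPlugInClassifier M ηhat h) (a : 𝒜) (k : Fin N)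
    (i j : Fin m) (c : ℕ → Fin m → Fin m → ℚ)
    (hin : ∀ v ∈ stdSimplex ℝ (Fin m), StrictMax (M a k) j v →
      ∀ᶠ r in atTop, StrictMax (ratMatrix (c r)) j v)
    (hout : ∀ v ∈ stdSimplex ℝ (Fin m), ¬ WeakMax (M a k) j v →
      ∀ᶠ r in atTop, ¬ StrictMax (ratMatrix (c r)) j v) :
    Tendsto (fun r => ∫ z, cellScore ηhat a k i j (ratMatrix (c r)) z.1
      ∂(ProbabilityTheory.cond P (groupSet 𝒳 m a k))) atTop
      (𝓝 (∫ z, ηhat z.1 a k i * h k z.1 a j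
        ∂(ProbabilityTheory.cond P (groupSet 𝒳 m a k)))) := by
  refine tendsto_integral_of_dominated_convergence (fun _ => 1)
    (fun r => ((measurable_cellScore hη a k i j _).comp measurable_fst).aestronglyMeasurable)
    (integrable_const _) (fun r => ae_of_all _ fun z => ?_) ?_
  · have := cellScore_mem_Icc hη a k i j (ratMatrix (c r)) z.1
    rw [Real.norm_eq_abs, abs_of_nonneg this.1]
    exact this.2
  · filter_upwards [ae_no_ties P hη hM a k] with z hz
    have hv := hη.mem_simplex z.1 a k
    by_cases hs : StrictMax (M a k) j (ηhat z.1 a k)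
    · have h0 : ∀ t, t ≠ j → h k z.1 a t = 0 := by
        intro t ht
        by_contra hne
        exact absurd (hh.2.2 k z.1 a t hne j) (not_le.2 (hs t ht))
      have h1 : h k z.1 a j = 1 := by
        rw [← (hh.2.1 k z.1 a).2]
        exact (Fintype.sum_eq_single j h0).symm
      rw [h1, mul_one]
      refine tendsto_const_nhds.congr' ?_
      filter_upwards [hin _ hv hs] with r hr
      rw [cellScore, if_pos hr]
    · have hw : ¬ WeakMax (M a k) j (ηhat z.1 a k) := fun hw =>
        hs fun t ht => lt_of_le_of_ne (hw t) (hz t j ht)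
      have h0 : h k z.1 a j = 0 := by
        by_contra hne
        exact hw (hh.2.2 k z.1 a j hne)
      rw [h0, mul_zero]
      refine tendsto_const_nhds.congr' ?_
      filter_upwards [hout _ hv hw] with r hr
      rw [cellScore, if_neg hr]

/-- On a representative sample, the empirical confusion matrix of every selection of maximizing
labels is close to its population counterpart. -/
theorem abs_empConfusion_sub_le {κ : Finset (Fin N)} {t : ℝ}
    {s : Fin N → Fin n → 𝒳 × 𝒜 × Fin m} (hs : Representative P ηhat κ t s)
    (hη : IsContinuousScore P ηhat)
    {M : 𝒜 → Fin N → Matrix (Fin m) (Fin m) ℝ} (hM : Nonsingular M)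
    {h : Fin N → 𝒳 → 𝒜 → Fin m → ℝ} (hh : IsPlugInClassifier M ηhat h) {a : 𝒜} {k : Fin N}
    (hk : k ∈ κ) (hP : 0 < P (groupSet 𝒳 m a k)) (hp : 0 < groupProb P a k)
    (hcard : 1 ≤ (groupIdx s a k).card) {Y : Fin n → Fin m}
    (hY : ∀ l, WeakMax (M a k) (Y l) (ηhat (s k l).1 a k)) (i j : Fin m) :
    |empConfusion s ηhat Y a k i j - ∫ z, ηhat z.1 a k i * h k z.1 a j
        ∂(ProbabilityTheory.cond P (groupSet 𝒳 m a k))| ≤ 2 * t / groupProb P a k := by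
  set p := groupProb P a k with hpdef
  set μ := ProbabilityTheory.cond P (groupSet 𝒳 m a k) with hμ
  set G := ∫ z, ηhat z.1 a k i * h k z.1 a j ∂μ with hG
  set S := ∑ l ∈ groupIdx s a k, (if Y l = j then ηhat (s k l).1 a k i else 0) with hS
  obtain ⟨hcnt, hcell⟩ := hs k hk a
  have hcnt' : |((groupIdx s a k).card : ℝ) - n * p| ≤ n * t := by
    rw [← Finset.sum_filter, Finset.sum_const, nsmul_eq_mul, mul_one] at hcnt
    exact hcnt
  have hcell' : ∀ c : Fin m → Fin m → ℚ,
      |∑ l ∈ groupIdx s a k, cellScore ηhat a k i j (ratMatrix c) (s k l).1 -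
        n * (p * ∫ z, cellScore ηhat a k i j (ratMatrix c) z.1 ∂μ)| ≤ n * t := by
    intro c
    have h1 := hcell i j c
    have h2 := integral_localLaw_eq P a k hP (cellScore ηhat a k i j (ratMatrix c))
      (measurable_cellScore hη a k i j _)
    unfold cellFn at h1
    rw [h2, ← Finset.sum_filter] at h1
    exact h1
  have hnn : ∀ l, 0 ≤ ηhat (s k l).1 a k i := fun l => (hη.mem_simplex _ a k).1 i
  -- Every sample labelled j is a weak maximum for j, hence in all outer rational cells. The
  -- deviation bound for those cells passes to the limit.
  have hup : S - n * (p * G) ≤ n * t := by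
    obtain ⟨c, hc⟩ := exists_outer_approximation (M a k) j
    have hlim := tendsto_integral_cellScore hη hM hh a k i j c
      (fun v hv hst => Eventually.of_forall ((hc v hv).1 fun t' => by
        by_cases htj : t' = j
        · rw [htj]
        · exact (hst t' htj).le)) (fun v hv => (hc v hv).2)
    have hlim' := (tendsto_const_nhds (x := S)).sub ((hlim.const_mul p).const_mul (n : ℝ))
    refine le_of_tendsto' hlim' fun r =>
      le_trans (sub_le_sub_right ?_ _) (abs_le.1 (hcell' (c r))).2
    refine Finset.sum_le_sum fun l _ => ?_
    by_cases hl : Y l = j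
    · rw [if_pos hl, cellScore, if_pos ((hc _ (hη.mem_simplex _ a k)).1 (hl ▸ hY l) r)]
    · rw [if_neg hl]
      exact (cellScore_mem_Icc hη a k i j _ _).1
  -- A sample in an inner rational cell is a strict maximum for j, so every maximizing selection is
  -- forced to label it j.
  have hlow : -(n * t) ≤ S - n * (p * G) := by
    obtain ⟨c, hc⟩ := exists_inner_approximation (M a k) j
    have hlim := tendsto_integral_cellScore hη hM hh a k i j c
      (fun v hv => (hc v hv).1) (fun v hv hw => Eventually.of_forall ((hc v hv).2 fun hst =>
        hw fun t' => by
        by_cases htj : t' = j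
        · rw [htj]
        · exact (hst t' htj).le))
    have hlim' := (tendsto_const_nhds (x := S)).sub ((hlim.const_mul p).const_mul (n : ℝ))
    refine ge_of_tendsto' hlim' fun r =>
      le_trans (abs_le.1 (hcell' (c r))).1 (sub_le_sub_right ?_ _)
    refine Finset.sum_le_sum fun l _ => ?_
    by_cases hst : StrictMax (ratMatrix (c r)) j (ηhat (s k l).1 a k)
    · have hM' : StrictMax (M a k) j (ηhat (s k l).1 a k) := by
        by_contra hne
        exact (hc _ (hη.mem_simplex _ a k)).2 hne r hst
      have hl : Y l = j := by
        by_contra hne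
        exact absurd (hY l j) (not_le.2 (hM' _ hne))
      rw [if_pos hl, cellScore, if_pos hst]
    · rw [cellScore, if_neg hst]
      split_ifs
      · exact hnn l
      · exact le_rfl
  have hc0 : (0 : ℝ) < (groupIdx s a k).card := by exact_mod_cast hcard
  have hn0 : (0 : ℝ) < n := by
    have : (groupIdx s a k).card ≤ n := by
      simpa using Finset.card_le_univ (groupIdx s a k)
    exact_mod_cast lt_of_lt_of_le hcard this
  have he : empConfusion s ηhat Y a k i j = S / (groupIdx s a k).card := by
    rw [empConfusion, one_div, div_eq_inv_mul]
  set q : ℝ := ((groupIdx s a k).card : ℝ) with hq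
  set x := S / q with hx
  have hSx : S = q * x := by rw [hx]; field_simp
  have hx0 : 0 ≤ x := div_nonneg (Finset.sum_nonneg fun l _ => by
    split_ifs
    · exact hnn l
    · exact le_rfl) hc0.le
  have hx1 : x ≤ 1 := by
    rw [hx, div_le_one hc0, hS, hq, Finset.card_eq_sum_ones, Nat.cast_sum]
    refine Finset.sum_le_sum fun l _ => ?_
    split_ifs
    · simpa using le_one_of_mem_stdSimplex (hη.mem_simplex _ a k) i
    · simp
  rw [he, le_div_iff₀ hp]
  have h1 : |n * p * x - n * p * G| ≤ n * t + n * t := by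
    -- Normalizing by the group count q instead of n p costs one more n t, as 0 ≤ x ≤ 1; hence the
    -- factor 2.
    have e1 : n * p * x - n * p * G = -((q - n * p) * x) + (S - n * (p * G)) := by
      rw [hSx]; ring
    rw [e1]
    refine (abs_add_le _ _).trans (add_le_add ?_ (abs_le.2 ⟨hlow, hup⟩))
    rw [abs_neg, abs_mul, abs_of_nonneg hx0]
    calc |q - n * p| * x ≤ |q - n * p| * 1 := by gcongr
      _ ≤ _ := by rw [mul_one]; exact hcnt'
  rw [show (n : ℝ) * p * x - n * p * G = n * ((x - G) * p) by ring, abs_mul,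
    abs_of_pos hn0, abs_mul, abs_of_pos hp] at h1
  nlinarith

end Empirical

/-! ### The deterministic disparity bound -/

section Disparity

variable {m : ℕ}

lemma frob_sub_left (A B C : Matrix (Fin m) (Fin m) ℝ) : frob (A - B) C = frob A C - frob B C := by
  simp only [frob, Matrix.sub_apply, sub_mul, Finset.sum_sub_distrib]

lemma abs_frob_sub_le {D A B : Matrix (Fin m) (Fin m) ℝ} {r : ℝ}
    (h : ∀ i j, |A i j - B i j| ≤ r) : |frob D A - frob D B| ≤ l1Norm D * r := by
  simp only [frob, l1Norm, ← Finset.sum_sub_distrib, Finset.sum_mul]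
  refine (Finset.abs_sum_le_sum_abs _ _).trans (Finset.sum_le_sum fun i _ =>
    (Finset.abs_sum_le_sum_abs _ _).trans (Finset.sum_le_sum fun j _ => ?_))
  rw [← mul_sub, abs_mul]
  exact mul_le_mul_of_nonneg_left (h i j) (abs_nonneg _)

/-- Duality of ℓ¹ and ℓ^∞: A is a probability distribution on pairs of labels, so no dimension
factor appears. -/
lemma abs_frob_le_lInfNorm {D A : Matrix (Fin m) (Fin m) ℝ} (h0 : ∀ i j, 0 ≤ A i j)
    (h1 : ∑ i, ∑ j, A i j = 1) : |frob D A| ≤ lInfNorm D := by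
  have hD : ∀ i j, |D i j| ≤ lInfNorm D := fun i j =>
    le_ciSup (f := fun ij : Fin m × Fin m => |D ij.1 ij.2|) (Set.finite_range _).bddAbove (i, j)
  calc |frob D A| ≤ ∑ i, ∑ j, lInfNorm D * A i j := by
        refine (Finset.abs_sum_le_sum_abs _ _).trans (Finset.sum_le_sum fun i _ =>
          (Finset.abs_sum_le_sum_abs _ _).trans (Finset.sum_le_sum fun j _ => ?_))
        rw [abs_mul, abs_of_nonneg (h0 i j)]
        exact mul_le_mul_of_nonneg_right (hD i j) (h0 i j)
    _ = lInfNorm D := by simp_rw [← Finset.mul_sum, h1, mul_one]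

variable {𝒳 𝒜 : Type*} [DecidableEq 𝒜] {N n : ℕ}

/-- Identifies the sums produced by first-order optimality with empirical disparities. -/
lemma frob_empConfusion (s : Fin N → Fin n → 𝒳 × 𝒜 × Fin m)
    (ηhat : 𝒳 → 𝒜 → Fin N → Fin m → ℝ) (Y : Fin n → Fin m) (a : 𝒜) (k : Fin N)
    (D : Matrix (Fin m) (Fin m) ℝ) :
    frob D (empConfusion s ηhat Y a k) = 1 / ((groupIdx s a k).card : ℝ) *
      ∑ l ∈ groupIdx s a k, (D.transpose.mulVec (ηhat (s k l).1 a k)) (Y l) := by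
  have h1 : ∀ l, (D.transpose.mulVec (ηhat (s k l).1 a k)) (Y l) =
      ∑ i, ∑ j, D i j * (if Y l = j then ηhat (s k l).1 a k i else 0) := by
    intro l
    simp [Matrix.mulVec, dotProduct, Matrix.transpose_apply]
  simp_rw [h1, frob, empConfusion]
  rw [Finset.sum_comm (s := groupIdx s a k), Finset.mul_sum]
  refine Finset.sum_congr rfl fun i _ => ?_
  rw [Finset.sum_comm (s := groupIdx s a k), Finset.mul_sum]
  refine Finset.sum_congr rfl fun j _ => ?_
  rw [← Finset.mul_sum]
  ring

variable [MeasurableSpace 𝒳] [MeasurableSpace 𝒜] [MeasurableSingletonClass 𝒜]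
  {P : Measure (𝒳 × 𝒜 × Fin m × Fin N)} [IsProbabilityMeasure P]
  {ηhat η : 𝒳 → 𝒜 → Fin N → Fin m → ℝ}

omit [MeasurableSingletonClass 𝒜] [IsProbabilityMeasure P] in
lemma empConfusion_nonneg (hη : IsContinuousScore P ηhat) (s : Fin N → Fin n → 𝒳 × 𝒜 × Fin m)
    (Y : Fin n → Fin m) (a : 𝒜) (k : Fin N) (i j : Fin m) :
    0 ≤ empConfusion s ηhat Y a k i j :=
  mul_nonneg (by positivity) (Finset.sum_nonneg fun l _ => by
    split_ifs
    · exact (hη.mem_simplex _ a k).1 i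
    · exact le_rfl)

omit [MeasurableSingletonClass 𝒜] [IsProbabilityMeasure P] in
lemma sum_empConfusion (hη : IsContinuousScore P ηhat) (s : Fin N → Fin n → 𝒳 × 𝒜 × Fin m)
    (Y : Fin n → Fin m) (a : 𝒜) (k : Fin N) (hcard : 1 ≤ (groupIdx s a k).card) :
    ∑ i, ∑ j, empConfusion s ηhat Y a k i j = 1 := by
  have h := frob_empConfusion s ηhat Y a k (fun _ _ => 1)
  simp only [frob, one_mul] at h
  rw [h]
  have h1 : ∀ l, (Matrix.mulVec (Matrix.transpose fun _ _ => (1 : ℝ))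
      (ηhat (s k l).1 a k)) (Y l) = 1 := fun l => by
    change ∑ i, (1 : ℝ) * ηhat (s k l).1 a k i = 1
    simp_rw [one_mul]
    exact (hη.mem_simplex _ a k).2
  simp_rw [h1]
  have : ((groupIdx s a k).card : ℝ) ≠ 0 := by
    have : (0 : ℝ) < (groupIdx s a k).card := by exact_mod_cast hcard
    exact this.ne'
  simp [this]

omit [DecidableEq 𝒜] in
/-- Replacing the Bayes score by the estimator changes the confusion matrix by at most the
estimation error. -/
lemma abs_integral_sub_confusion_le (hη : IsBayesScore P η) (hηhat : IsContinuousScore P ηhat)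
    (h : 𝒳 → 𝒜 → Fin m → ℝ) (a : 𝒜) (k : Fin N) (hh : Measurable fun x => h x a)
    (hs : ∀ x, h x a ∈ stdSimplex ℝ (Fin m)) (i j : Fin m) :
    |∫ z, ηhat z.1 a k i * h z.1 a j ∂(ProbabilityTheory.cond P (groupSet 𝒳 m a k)) -
      confusion P h a k i j| ≤ scoreDist P ηhat η a k i := by
  have hηm : Measurable fun z : 𝒳 × 𝒜 × Fin m × Fin N => η z.1 a k i :=
    ((measurable_pi_apply i).comp (hη.measurable a k)).comp measurable_fst
  have hηhm : Measurable fun z : 𝒳 × 𝒜 × Fin m × Fin N => ηhat z.1 a k i :=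
    ((measurable_pi_apply i).comp (hηhat.measurable a k)).comp measurable_fst
  have hhm : Measurable fun z : 𝒳 × 𝒜 × Fin m × Fin N => h z.1 a j :=
    ((measurable_pi_apply j).comp hh).comp measurable_fst
  have b1 : ∀ z : 𝒳 × 𝒜 × Fin m × Fin N, η z.1 a k i ∈ Set.Icc (0 : ℝ) 1 := fun z =>
    ⟨(hη.mem_simplex _ a k).1 i, le_one_of_mem_stdSimplex (hη.mem_simplex _ a k) i⟩
  have b2 : ∀ z : 𝒳 × 𝒜 × Fin m × Fin N, ηhat z.1 a k i ∈ Set.Icc (0 : ℝ) 1 := fun z =>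
    ⟨(hηhat.mem_simplex _ a k).1 i, le_one_of_mem_stdSimplex (hηhat.mem_simplex _ a k) i⟩
  have b3 : ∀ z : 𝒳 × 𝒜 × Fin m × Fin N, h z.1 a j ∈ Set.Icc (0 : ℝ) 1 := fun z =>
    ⟨(hs _).1 j, le_one_of_mem_stdSimplex (hs _) j⟩
  set μ := ProbabilityTheory.cond P (groupSet 𝒳 m a k) with hμ
  have i1 : Integrable (fun z => η z.1 a k i * h z.1 a j) μ :=
    Integrable.of_bound (hηm.mul hhm).aestronglyMeasurable 1 (ae_of_all _ fun z => by
      rw [Real.norm_eq_abs, abs_of_nonneg (mul_nonneg (b1 z).1 (b3 z).1)]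
      exact mul_le_one₀ (b1 z).2 (b3 z).1 (b3 z).2)
  have i2 : Integrable (fun z => ηhat z.1 a k i * h z.1 a j) μ :=
    Integrable.of_bound (hηhm.mul hhm).aestronglyMeasurable 1 (ae_of_all _ fun z => by
      rw [Real.norm_eq_abs, abs_of_nonneg (mul_nonneg (b2 z).1 (b3 z).1)]
      exact mul_le_one₀ (b2 z).2 (b3 z).1 (b3 z).2)
  have i3 : Integrable (fun z => |ηhat z.1 a k i - η z.1 a k i|) μ :=
    Integrable.of_bound (hηhm.sub hηm).abs.aestronglyMeasurable 1 (ae_of_all _ fun z => by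
      rw [Real.norm_eq_abs, abs_abs, abs_le]
      constructor <;> linarith [(b1 z).1, (b1 z).2, (b2 z).1, (b2 z).2])
  rw [confusion_eq P hη h a k hh i j, ← integral_sub i2 i1]
  refine abs_integral_le_integral_abs.trans (integral_mono_of_nonneg
    (ae_of_all _ fun z => abs_nonneg _) i3 (ae_of_all _ fun z => ?_))
  simp only [← sub_mul, abs_mul, abs_of_nonneg (b3 z).1]
  exact mul_le_of_le_one_right (abs_nonneg _) (b3 z).2

/-- The disparity of a plug-in classifier whose empirical counterpart is feasible. -/
theorem disparity_le [Fintype 𝒜] {κ : Finset (Fin N)} {t : ℝ}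
    {s : Fin N → Fin n → 𝒳 × 𝒜 × Fin m} (hs : Representative P ηhat κ t s)
    (hη : IsBayesScore P η) (hηhat : IsContinuousScore P ηhat)
    {M : 𝒜 → Fin N → Matrix (Fin m) (Fin m) ℝ} (hM : Nonsingular M)
    {h : Fin N → 𝒳 → 𝒜 → Fin m → ℝ} (hh : IsPlugInClassifier M ηhat h)
    (hP : ∀ a k, 0 < P (groupSet 𝒳 m a k)) {pm : ℝ} (hpm : 0 < pm)
    (hpa : ∀ a k, pm ≤ groupProb P a k) (ht : 0 ≤ t)
    (hcard : ∀ a k, 1 ≤ (groupIdx s a k).card)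
    {D Dhat : 𝒜 → Fin N → Matrix (Fin m) (Fin m) ℝ} {B ε ξ e : ℝ}
    (hB : ∀ a, ∀ k ∈ κ, l1Norm (D a k) ≤ B)
    (hε : ∀ a, ∀ k ∈ κ, ∀ i, scoreDist P ηhat η a k i ≤ ε) (he : e = 1 ∨ e = -1)
    (hfeas : ∃ Y : Fin N → 𝒜 → Fin n → Fin m,
      (∀ k a i, WeakMax (M a k) (Y k a i) (ηhat (s k i).1 a k)) ∧
      e * ∑ a, ∑ k ∈ κ, (1 / ((groupIdx s a k).card : ℝ)) *
        ∑ i ∈ groupIdx s a k, ((Dhat a k).transpose.mulVec (ηhat (s k i).1 a k)) (Y k a i) ≤ ξ) :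
    e * ∑ a, ∑ k ∈ κ, frob (D a k) (confusion P (h k) a k) ≤
      ξ + ∑ a, ∑ k ∈ κ, lInfNorm (D a k - Dhat a k) +
        Fintype.card 𝒜 * (κ.card * (B * (2 * t / pm + ε))) := by
  obtain ⟨Y, hY, hf⟩ := hfeas
  simp_rw [← frob_empConfusion] at hf
  have hterm : ∀ a, ∀ k ∈ κ, e * frob (D a k) (confusion P (h k) a k) ≤
      e * frob (Dhat a k) (empConfusion s ηhat (Y k a) a k) + lInfNorm (D a k - Dhat a k) +
        B * (2 * t / pm + ε) := by
    intro a k hk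
    have h1 : ∀ i j, |empConfusion s ηhat (Y k a) a k i j - confusion P (h k) a k i j| ≤
        2 * t / pm + ε := by
      intro i j
      have e1 := abs_empConfusion_sub_le hs hηhat hM hh hk (hP a k) (hpm.trans_le (hpa a k))
        (hcard a k) (hY k a) i j
      have e2 := abs_integral_sub_confusion_le hη hηhat (h k) a k (hh.1 k a)
        (fun x => hh.2.1 k x a) i j
      have e3 : 2 * t / groupProb P a k ≤ 2 * t / pm :=
        div_le_div_of_nonneg_left (by positivity) hpm (hpa a k)
      exact (abs_sub_le _ _ _).trans (add_le_add (e1.trans e3) (e2.trans (hε a k hk i)))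
    have h2 := abs_frob_sub_le (D := D a k) h1
    have h3 := abs_frob_le_lInfNorm (D := D a k - Dhat a k)
      (empConfusion_nonneg hηhat s (Y k a) a k) (sum_empConfusion hηhat s (Y k a) a k (hcard a k))
    rw [frob_sub_left] at h3
    have h5 : l1Norm (D a k) * (2 * t / pm + ε) ≤ B * (2 * t / pm + ε) := by
      -- Enlarging the norm to B needs 2t/pm + ε ≥ 0, which is read off from any entry bound; for m
      -- = 0 the entries could not sum to one.
      rcases isEmpty_or_nonempty (Fin m) with hm | ⟨⟨i⟩⟩
      · exact absurd (sum_empConfusion hηhat s (Y k a) a k (hcard a k)) (by simp)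
      · exact mul_le_mul_of_nonneg_right (hB a k hk) ((abs_nonneg _).trans (h1 i i))
    have h2' := abs_le.1 (h2.trans h5)
    have h3' := abs_le.1 h3
    rcases he with rfl | rfl <;> linarith [h2'.1, h2'.2, h3'.1, h3'.2]
  calc e * ∑ a, ∑ k ∈ κ, frob (D a k) (confusion P (h k) a k)
      = ∑ a, ∑ k ∈ κ, e * frob (D a k) (confusion P (h k) a k) := by
        simp_rw [Finset.mul_sum]
    _ ≤ ∑ a, ∑ k ∈ κ, (e * frob (Dhat a k) (empConfusion s ηhat (Y k a) a k) +
          lInfNorm (D a k - Dhat a k) + B * (2 * t / pm + ε)) :=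
        Finset.sum_le_sum fun a _ => Finset.sum_le_sum fun k hk => hterm a k hk
    _ = e * ∑ a, ∑ k ∈ κ, frob (Dhat a k) (empConfusion s ηhat (Y k a) a k) +
          ∑ a, ∑ k ∈ κ, lInfNorm (D a k - Dhat a k) +
          Fintype.card 𝒜 * (κ.card * (B * (2 * t / pm + ε))) := by
        simp only [Finset.sum_add_distrib, Finset.mul_sum, Finset.sum_const, nsmul_eq_mul,
          Finset.card_univ]
    _ ≤ _ := by gcongr

end Disparity

/-! ### Probability of a representative sample -/

section Representative

variable {𝒳 𝒜 Ω : Type*} [MeasurableSpace 𝒳] [MeasurableSpace 𝒜] [MeasurableSingletonClass 𝒜]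
  [MeasurableSpace Ω] {m N n : ℕ} {P : Measure (𝒳 × 𝒜 × Fin m × Fin N)} [IsProbabilityMeasure P]

omit [MeasurableSingletonClass 𝒜] in
lemma groupProb_pos {a : 𝒜} {k : Fin N} (hP : 0 < P (groupSet 𝒳 m a k)) :
    0 < groupProb P a k := by
  have hset : clientSet 𝒳 𝒜 m k ∩ {z | z.2.1 = a} = groupSet 𝒳 m a k := by
    ext z; simp only [clientSet, groupSet, Set.mem_inter_iff, Set.mem_ofPred_eq]; tauto
  rw [groupProb, measureReal_def, cond_apply (measurableSet_clientSet k), hset, ENNReal.toReal_mul]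
  exact mul_pos (ENNReal.toReal_pos (ENNReal.inv_ne_zero.2 (measure_ne_top _ _))
      (ENNReal.inv_ne_top.2 (hP.trans_le (measure_mono fun z hz => hz.2)).ne'))
    (ENNReal.toReal_pos hP.ne' (measure_ne_top _ _))

variable [Fintype 𝒜]

omit [MeasurableSingletonClass 𝒜] [IsProbabilityMeasure P] in
lemma pMin_le (a : 𝒜) (k : Fin N) : pMin P ≤ groupProb P a k :=
  ciInf_le (f := fun ak : 𝒜 × Fin N => groupProb P ak.1 ak.2) (Set.finite_range _).bddBelow (a, k)

omit [MeasurableSingletonClass 𝒜] in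
lemma pMin_pos [Nonempty 𝒜] [Nonempty (Fin N)] (hP : ∀ a k, 0 < P (groupSet 𝒳 m a k)) :
    0 < pMin P := by
  obtain ⟨ak, h⟩ := exists_eq_ciInf_of_finite (f := fun ak : 𝒜 × Fin N => groupProb P ak.1 ak.2)
  rw [pMin, ← h]
  exact groupProb_pos (hP _ _)

/-- The rate `ρ` beats the growth function of the decision regions. -/
lemma growth_mul_exp_rho_le {cardA m N n : ℕ} {δ : ℝ} (hA : 1 ≤ cardA) (hm : 1 ≤ m) (hn : 1 ≤ n)
    (hL : 1 ≤ (m : ℝ) ^ 2 * cardA * N / δ) :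
    4 * (((n + n + 1) ^ (m * m) : ℕ) : ℝ) * Real.exp (-(n * rho cardA m N n δ ^ 2 / 2)) ≤
      ((m : ℝ) ^ 2 * cardA * N / δ)⁻¹ := by
  set L : ℝ := (m : ℝ) ^ 2 * cardA * N / δ with hLdef
  have hn' : (1 : ℝ) ≤ n := by exact_mod_cast hn
  have hA' : (1 : ℝ) ≤ cardA := by exact_mod_cast hA
  have hlog : 0 ≤ Real.log ((n : ℝ) + 1) := Real.log_nonneg (by linarith)
  have hlogL : 0 ≤ Real.log L := Real.log_nonneg hL
  have hα : 0 ≤ 8 * (cardA : ℝ) * (m : ℝ) ^ 2 * Real.log ((n : ℝ) + 1) / n := by positivity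
  have hβ : 0 ≤ 2 * Real.log L / n := by positivity
  have hrho : 8 * (cardA : ℝ) * (m : ℝ) ^ 2 * Real.log ((n : ℝ) + 1) / n + 2 * Real.log L / n ≤
      -- The square of the sum dominates the sum of the squares; the cross term is dropped.
      rho cardA m N n δ ^ 2 := by
    rw [rho, add_sq, Real.sq_sqrt hα, Real.sq_sqrt hβ]
    have := mul_nonneg (Real.sqrt_nonneg (8 * (cardA : ℝ) * (m : ℝ) ^ 2 *
      Real.log ((n : ℝ) + 1) / n)) (Real.sqrt_nonneg (2 * Real.log L / n))
    linarith
  have hexp : ((4 * (m * m) : ℕ) : ℝ) * Real.log ((n : ℝ) + 1) + Real.log L ≤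
      n * rho cardA m N n δ ^ 2 / 2 := by
    have h1 := mul_le_mul_of_nonneg_left hrho (by linarith : (0 : ℝ) ≤ n)
    have h2 : (n : ℝ) * (8 * (cardA : ℝ) * (m : ℝ) ^ 2 * Real.log ((n : ℝ) + 1) / n +
        2 * Real.log L / n) = 8 * (cardA * ((m : ℝ) ^ 2 * Real.log ((n : ℝ) + 1))) +
        2 * Real.log L := by
      have : (n : ℝ) ≠ 0 := by linarith
      field_simp
    have h3 : (m : ℝ) ^ 2 * Real.log ((n : ℝ) + 1) ≤
        cardA * ((m : ℝ) ^ 2 * Real.log ((n : ℝ) + 1)) :=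
      le_mul_of_one_le_left (by positivity) hA'
    push_cast
    rw [h2] at h1
    linarith
  -- Uses 4 ≤ (n+1)² and 2n+1 ≤ (n+1)² for n ≥ 1, then 2 + 2m² ≤ 4m².
  have hG : 4 * (((n + n + 1) ^ (m * m) : ℕ) : ℝ) ≤ ((n : ℝ) + 1) ^ (4 * (m * m)) := by
    have h1 : 4 * (n + n + 1) ^ (m * m) ≤ (n + 1) ^ (4 * (m * m)) := by
      calc 4 * (n + n + 1) ^ (m * m) ≤ (n + 1) ^ 2 * ((n + 1) ^ 2) ^ (m * m) := by
            gcongr <;> nlinarith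
        _ = (n + 1) ^ (2 + 2 * (m * m)) := by rw [← pow_mul, ← pow_add]
        _ ≤ (n + 1) ^ (4 * (m * m)) := Nat.pow_le_pow_right (by omega) (by nlinarith)
    exact_mod_cast h1
  have hn1 : (0 : ℝ) < (n : ℝ) + 1 := by linarith
  calc 4 * (((n + n + 1) ^ (m * m) : ℕ) : ℝ) * Real.exp (-(n * rho cardA m N n δ ^ 2 / 2))
      ≤ ((n : ℝ) + 1) ^ (4 * (m * m)) *
        Real.exp (-(((4 * (m * m) : ℕ) : ℝ) * Real.log ((n : ℝ) + 1) + Real.log L)) := by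
        gcongr
    _ = L⁻¹ := by
        rw [Real.exp_neg, Real.exp_add, ← Real.log_pow, Real.exp_log (by positivity),
          Real.exp_log (by linarith), mul_inv, ← mul_assoc, mul_inv_cancel₀ (by positivity),
          one_mul]

variable [DecidableEq 𝒜] {ηhat : 𝒳 → 𝒜 → Fin N → Fin m → ℝ}

/-- Samples are representative up to `ρ` with high probability. -/
theorem exists_representative_event (hP : ∀ a k, 0 < P (groupSet 𝒳 m a k))
    (hη : IsContinuousScore P ηhat) (Q : Measure Ω) [IsProbabilityMeasure Q]
    (S : Fin N → Fin n → Ω → 𝒳 × 𝒜 × Fin m) (hS : ∀ k i, Measurable (S k i))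
    (hlaw : ∀ k i, Q.map (S k i) = localLaw P k) (hind : ∀ k, iIndepFun (S k) Q)
    (κ : Finset (Fin N)) {δ : ℝ} (hA : 1 ≤ Fintype.card 𝒜) (hm : 1 ≤ m) (hn : 1 ≤ n)
    (hL : 1 ≤ (m : ℝ) ^ 2 * Fintype.card 𝒜 * N / δ) :
    ∃ E : Set Ω, MeasurableSet E ∧
      1 - κ.card * (Fintype.card 𝒜 * ((m : ℝ) ^ 2 *
        ((m : ℝ) ^ 2 * Fintype.card 𝒜 * N / δ)⁻¹)) ≤ Q.real E ∧
      ∀ ω ∈ E, Representative P ηhat κ (rho (Fintype.card 𝒜) m N n δ) fun k i => S k i ω := by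
  set t := rho (Fintype.card 𝒜) m N n δ with ht
  have ht0 : 0 ≤ t := add_nonneg (Real.sqrt_nonneg _) (Real.sqrt_nonneg _)
  have hprob : ∀ k, IsProbabilityMeasure (localLaw P k) := fun k => by
    rw [← hlaw k ⟨0, hn⟩]
    exact Measure.isProbabilityMeasure_map (hS k _).aemeasurable
  set G : ℕ := (n + n + 1) ^ (m * m) with hG
  have hG1 : (1 : ℝ) ≤ G := by
    rw [hG]; exact_mod_cast Nat.one_le_pow _ _ (by omega)
  have hm' : (1 : ℝ) ≤ (m : ℝ) ^ 2 := by
    exact_mod_cast Nat.one_le_pow _ _ hm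
  set bad₀ : Fin N → 𝒜 → Set Ω := fun k a => {ω | n * t <
    |∑ l, (if (S k l ω).2.1 = a then (1 : ℝ) else 0) - n * groupProb P a k|} with hbad₀
  set bad : Fin N → 𝒜 → Fin m × Fin m → Set Ω := fun k a ij =>
    {ω | ∃ c : Fin m → Fin m → ℚ, n * t < |∑ l, cellFn ηhat a k ij.1 ij.2 (ratMatrix c) (S k l ω) -
      n * ∫ y, cellFn ηhat a k ij.1 ij.2 (ratMatrix c) y ∂(localLaw P k)|} with hbad
  have hm0 : ∀ k a, MeasurableSet (bad₀ k a) := fun k a => by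
    refine measurableSet_lt measurable_const ((Measurable.sub ?_ measurable_const).abs)
    exact Finset.measurable_sum _ fun l _ => Measurable.ite
      ((measurable_fst.comp (measurable_snd.comp (hS k l))) (measurableSet_singleton a))
      measurable_const measurable_const
  have hm1 : ∀ k a ij, MeasurableSet (bad k a ij) := fun k a ij => by
    simp only [hbad]
    rw [Set.ofPred_exists]
    refine MeasurableSet.iUnion fun c => ?_
    refine measurableSet_lt measurable_const ((Measurable.sub ?_ measurable_const).abs)
    exact Finset.measurable_sum _ fun l _ => (measurable_cellFn hη a k _ _ _).comp (hS k l)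
  have hq0 : ∀ k a, Q.real (bad₀ k a) ≤ 2 * G * Real.exp (-(n * t ^ 2 / 2)) := by
    intro k a
    have hmean : ∫ s, (if s.2.1 = a then (1 : ℝ) else 0) ∂(localLaw P k) = groupProb P a k := by
      have := cond_isProbabilityMeasure (hP a k).ne'
      have h := integral_localLaw_eq P a k (hP a k) (fun _ => 1) measurable_const
      rw [h]; simp
    -- The group count is the deviation of a single indicator, a class with one pattern.
    have h := measureReal_exists_deviation_le Q (S k) (hS k) (localLaw P k) (hlaw k) (hind k)
      (fun (_ : Unit) s => if s.2.1 = a then (1 : ℝ) else 0)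
      (fun _ => Measurable.ite ((measurable_fst.comp measurable_snd) (measurableSet_singleton a))
        measurable_const measurable_const)
      (fun _ s => by split_ifs <;> simp) 1
      (fun p => ⟨{()}, by simp, fun c => ⟨(), by simp, fun q => rfl⟩⟩) t ht0
    simp only [exists_const, hmean] at h
    refine h.trans ?_
    gcongr
    exact_mod_cast hG1
  have hq1 : ∀ k a ij, Q.real (bad k a ij) ≤ 2 * G * Real.exp (-(n * t ^ 2 / 2)) := by
    intro k a ij
    refine measureReal_exists_deviation_le Q (S k) (hS k) (localLaw P k) (hlaw k) (hind k)
      (fun c => cellFn ηhat a k ij.1 ij.2 (ratMatrix c)) (fun c => measurable_cellFn hη a k _ _ _)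
      (fun c s => cellFn_mem_Icc hη a k _ _ _ s) G (fun p => ?_) t ht0
    -- The points are the sample and its ghost copy, 2n in all. The value of a cell function at a
    -- point depends on the matrix only through membership in the cell.
    obtain ⟨T, hT, hr⟩ := exists_representatives_strictMax
      (ratMatrix (m := m)) ij.2 (fun q => ηhat (p q).1 a k)
    refine ⟨T, by simpa [hG] using hT, fun c => ?_⟩
    obtain ⟨c', hc', he⟩ := hr c
    refine ⟨c', hc', fun q => ?_⟩
    have hcell : cellScore ηhat a k ij.1 ij.2 (ratMatrix c) (p q).1 =
        cellScore ηhat a k ij.1 ij.2 (ratMatrix c') (p q).1 := by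
      unfold cellScore
      by_cases hst : StrictMax (ratMatrix c) ij.2 (ηhat (p q).1 a k)
      · rw [if_pos hst, if_pos ((he q).1 hst)]
      · rw [if_neg hst, if_neg fun h => hst ((he q).2 h)]
    simp only [cellFn, hcell]
  set U : Set Ω := ⋃ k ∈ κ, ⋃ a ∈ (Finset.univ : Finset 𝒜),
    (bad₀ k a ∪ ⋃ ij ∈ (Finset.univ : Finset (Fin m × Fin m)), bad k a ij) with hU
  have hUm : MeasurableSet U :=
    Finset.measurableSet_biUnion _ fun k _ => Finset.measurableSet_biUnion _ fun a _ =>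
      (hm0 k a).union (Finset.measurableSet_biUnion _ fun ij _ => hm1 k a ij)
  have hUq : Q.real U ≤ κ.card * (Fintype.card 𝒜 * ((m : ℝ) ^ 2 *
        ((m : ℝ) ^ 2 * Fintype.card 𝒜 * N / δ)⁻¹)) := by
    have hone : ∀ k a, Q.real (bad₀ k a ∪ ⋃ ij ∈ (Finset.univ : Finset (Fin m × Fin m)),
        bad k a ij) ≤ (m : ℝ) ^ 2 * ((m : ℝ) ^ 2 * Fintype.card 𝒜 * N / δ)⁻¹ := by
      intro k a
      calc _ ≤ 2 * G * Real.exp (-(n * t ^ 2 / 2)) +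
            ∑ _ij : Fin m × Fin m, 2 * G * Real.exp (-(n * t ^ 2 / 2)) :=
            (measureReal_union_le _ _).trans (add_le_add (hq0 k a)
              ((measureReal_biUnion_finset_le _ _).trans
                (Finset.sum_le_sum fun ij _ => hq1 k a ij)))
        _ = (1 + (m : ℝ) ^ 2) * (2 * G * Real.exp (-(n * t ^ 2 / 2))) := by
            simp [pow_two]; ring
        -- One count event and m² cell events: 1 + m² ≤ 2m² turns the factor 2 into 4.
        _ ≤ (m : ℝ) ^ 2 * (4 * G * Real.exp (-(n * t ^ 2 / 2))) := by
            have : 0 ≤ 2 * G * Real.exp (-(n * t ^ 2 / 2)) := by positivity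
            nlinarith
        _ ≤ _ := by
            gcongr
            exact growth_mul_exp_rho_le hA hm hn hL
    calc Q.real U ≤ ∑ k ∈ κ, ∑ a : 𝒜, (m : ℝ) ^ 2 *
          ((m : ℝ) ^ 2 * Fintype.card 𝒜 * N / δ)⁻¹ :=
          (measureReal_biUnion_finset_le _ _).trans (Finset.sum_le_sum fun k _ =>
            (measureReal_biUnion_finset_le _ _).trans (Finset.sum_le_sum fun a _ => hone k a))
      _ = _ := by simp only [Finset.sum_const, nsmul_eq_mul, Finset.card_univ]
  refine ⟨Uᶜ, hUm.compl, ?_, fun ω hω k hk a => ?_⟩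
  · rw [probReal_compl_eq_one_sub hUm]
    linarith
  · simp only [hU, Set.mem_compl_iff, Set.mem_iUnion, not_exists, Set.mem_union, not_or] at hω
    obtain ⟨h0, h1⟩ := hω k hk a (Finset.mem_univ a)
    refine ⟨not_lt.1 h0, fun i j c => not_lt.1 fun hlt => ?_⟩
    exact h1 (i, j) (Finset.mem_univ _) ⟨c, hlt⟩

end Representative

/-! ### Non-negativity of norms and non-empty groups -/

section Norms

variable {𝒜 : Type*} {m N : ℕ}

lemma l1Norm_nonneg (A : Matrix (Fin m) (Fin m) ℝ) : 0 ≤ l1Norm A :=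
  Finset.sum_nonneg fun _ _ => Finset.sum_nonneg fun _ _ => abs_nonneg _

lemma normG_nonneg (D : 𝒜 → Fin N → Matrix (Fin m) (Fin m) ℝ) : 0 ≤ normG D :=
  Real.iSup_nonneg fun _ => l1Norm_nonneg _

lemma normL_nonneg (D : 𝒜 → Matrix (Fin m) (Fin m) ℝ) : 0 ≤ normL D :=
  Real.iSup_nonneg fun _ => l1Norm_nonneg _

lemma one_le_card_groupIdx [Finite 𝒜] [DecidableEq 𝒜] {𝒳 : Type*} {n : ℕ}
    {s : Fin N → Fin n → 𝒳 × 𝒜 × Fin m} (h : 1 ≤ nMin s) (a : 𝒜) (k : Fin N) :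
    1 ≤ (groupIdx s a k).card :=
  h.trans (ciInf_le (f := fun ak : 𝒜 × Fin N => (groupIdx s ak.1 ak.2).card)
    (Set.finite_range _).bddBelow (a, k))

end Norms

end FedFair

/-! ### Global and local disparity bounds -/

theorem mainTheorem7 :
    ∃ C : ℝ → ℝ, (∀ p, 0 < p → 0 < C p) ∧
    ∀ {𝒳 𝒜 Ω Ug : Type*} [MeasurableSpace 𝒳]
      [MeasurableSpace 𝒜] [MeasurableSingletonClass 𝒜] [Fintype 𝒜] [DecidableEq 𝒜]
      [MeasurableSpace Ω] [Fintype Ug] (m N n : ℕ)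
      (Ul : Fin N → Type*) [∀ k, Fintype (Ul k)]
      -- the population and its Bayes score
      (P : Measure (𝒳 × 𝒜 × Fin m × Fin N)) [IsProbabilityMeasure P]
      (_ : ∀ a k, 0 < P (FedFair.groupSet 𝒳 m a k))
      (η : 𝒳 → 𝒜 → Fin N → Fin m → ℝ) (_ : FedFair.IsBayesScore P η)
      -- the pre-trained score estimator
      (ηhat : 𝒳 → 𝒜 → Fin N → Fin m → ℝ) (_ : FedFair.IsContinuousScore P ηhat)
      -- the fairness constraints
      (Dg : Ug → 𝒜 → Fin N → Matrix (Fin m) (Fin m) ℝ)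
      (Dl : (k : Fin N) → Ul k → 𝒜 → Matrix (Fin m) (Fin m) ℝ)
      (ξg : ℝ) (_ : 0 < ξg) (ξl : Fin N → ℝ) (_ : ∀ k, 0 < ξl k)
      -- the local datasets
      (Q : Measure Ω) [IsProbabilityMeasure Q]
      (S : Fin N → Fin n → Ω → 𝒳 × 𝒜 × Fin m)
      (_ : ∀ k i, Measurable (S k i))
      (_ : ∀ k i, Q.map (S k i) = FedFair.localLaw P k)
      (_ : ∀ k, iIndepFun (S k) Q)
      (δ : ℝ) (_ : 0 < δ) (_ : δ < 1),
      -- global constraints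
      (∃ E : Set Ω, MeasurableSet E ∧ 1 - 2 * (Fintype.card 𝒜 : ℝ) * δ ≤ Q.real E ∧
        ∀ ω ∈ E, ∀ (phat : 𝒜 → Fin N → ℝ)
          (Dghat : Ug → 𝒜 → Fin N → Matrix (Fin m) (Fin m) ℝ)
          (Dlhat : (k : Fin N) → Ul k → 𝒜 → Matrix (Fin m) (Fin m) ℝ)
          (θ : FedFair.Dual Ug Ul) (h : Fin N → 𝒳 → 𝒜 → Fin m → ℝ),
          (∀ a k, 0 < phat a k) →
          1 ≤ FedFair.nMin (fun k i => S k i ω) →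
          FedFair.IsEmpOptimal (fun k i => S k i ω) ηhat ξg ξl phat Dghat Dlhat θ →
          FedFair.Nonsingular (FedFair.calib phat Dghat Dlhat θ) →
          FedFair.IsPlugInClassifier (FedFair.calib phat Dghat Dlhat θ) ηhat h →
          ∀ u : Ug,
            2 * Fintype.card 𝒜 * N * FedFair.normG (Dghat u) / (FedFair.pMin P * ξg)
                + 1 / (2 * FedFair.pMin P ^ 2) * Real.log (1 / δ) < (n : ℝ) →
            |FedFair.globalDisparity P (Dg u) h| ≤
              ξg
              + C (FedFair.pMin P) * (Fintype.card 𝒜 * N * FedFair.normG (Dg u) *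
                  FedFair.rho (Fintype.card 𝒜) m N n (δ / (Fintype.card 𝒜 * Fintype.card Ug)))
              + FedFair.omegaG (Dg u) (Dghat u)
              + Fintype.card 𝒜 * N * FedFair.normG (Dghat u)
                  / (FedFair.nMin (fun k i => S k i ω) : ℝ)
              + Fintype.card 𝒜 * N * FedFair.normG (Dg u) *
                  ⨆ q : 𝒜 × Fin N × Fin m, FedFair.scoreDist P ηhat η q.1 q.2.1 q.2.2) ∧
      -- local constraints of each client
      (∀ k : Fin N,
        ∃ E : Set Ω, MeasurableSet E ∧ 1 - 2 * (Fintype.card 𝒜 : ℝ) * δ ≤ Q.real E ∧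
        ∀ ω ∈ E, ∀ (phat : 𝒜 → Fin N → ℝ)
          (Dghat : Ug → 𝒜 → Fin N → Matrix (Fin m) (Fin m) ℝ)
          (Dlhat : (k : Fin N) → Ul k → 𝒜 → Matrix (Fin m) (Fin m) ℝ)
          (θ : FedFair.Dual Ug Ul) (h : Fin N → 𝒳 → 𝒜 → Fin m → ℝ),
          (∀ a k, 0 < phat a k) →
          1 ≤ FedFair.nMin (fun k i => S k i ω) →
          FedFair.IsEmpOptimal (fun k i => S k i ω) ηhat ξg ξl phat Dghat Dlhat θ →
          FedFair.Nonsingular (FedFair.calib phat Dghat Dlhat θ) →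
          FedFair.IsPlugInClassifier (FedFair.calib phat Dghat Dlhat θ) ηhat h →
          ∀ u : Ul k,
            2 * Fintype.card 𝒜 * FedFair.normL (Dlhat k u) / (FedFair.pMin P * ξl k)
                + 1 / (2 * FedFair.pMin P ^ 2) * Real.log (1 / δ) < (n : ℝ) →
            |FedFair.localDisparity P k (Dl k u) h| ≤
              ξl k
              + C (FedFair.pMin P) * (Fintype.card 𝒜 * FedFair.normL (Dl k u) *
                  FedFair.rho (Fintype.card 𝒜) m N n
                    (N * δ / (Fintype.card 𝒜 * Fintype.card (Ul k))))
              + FedFair.omegaL (Dl k u) (Dlhat k u)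
              + Fintype.card 𝒜 * FedFair.normL (Dlhat k u)
                  / (FedFair.nMin (fun k i => S k i ω) : ℝ)
              + Fintype.card 𝒜 * FedFair.normL (Dl k u) *
                  ⨆ q : 𝒜 × Fin m, FedFair.scoreDist P ηhat η q.1 k q.2) := by
  -- The deviation 2ρ / p_min of a confusion entry dictates this constant.
  refine ⟨fun p => 2 / p, fun p hp => by positivity, ?_⟩
  intro 𝒳 𝒜 Ω Ug _ _ _ _ _ _ _ m N n Ul _ P _ hP η hη ηhat hηhat Dg Dl ξg _ ξl _ Q _ S hS hlaw
    hind δ hδ0 _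
  obtain ⟨⟨-, a₀, y₀, k₀⟩⟩ := nonempty_of_isProbabilityMeasure P
  have hm : 0 < m := y₀.pos
  have hN : 0 < N := k₀.pos
  have : Nonempty 𝒜 := ⟨a₀⟩
  have : Nonempty (Fin N) := ⟨k₀⟩
  have hA : 1 ≤ Fintype.card 𝒜 := Fintype.card_pos
  have hm' : (1 : ℝ) ≤ (m : ℝ) ^ 2 := by exact_mod_cast Nat.one_le_pow _ _ hm
  have hN' : (1 : ℝ) ≤ N := by exact_mod_cast hN
  have hA' : (1 : ℝ) ≤ Fintype.card 𝒜 := by exact_mod_cast hA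
  have hpm : 0 < FedFair.pMin P := FedFair.pMin_pos hP
  have hδA : δ ≤ 2 * (Fintype.card 𝒜 : ℝ) * δ := le_mul_of_one_le_left hδ0.le (by linarith)
  have huniv : 1 - 2 * (Fintype.card 𝒜 : ℝ) * δ ≤ Q.real Set.univ := by
    rw [probReal_univ]; linarith
  rcases Nat.eq_zero_or_pos n with rfl | hn
  · have hvac : ∀ ω, ¬ 1 ≤ FedFair.nMin (fun k i => S k i ω) := fun ω h =>
      absurd (FedFair.one_le_card_groupIdx h a₀ k₀) (by simp [FedFair.groupIdx])
    exact ⟨⟨Set.univ, MeasurableSet.univ, huniv, fun ω _ _ _ _ _ _ _ h => absurd h (hvac ω)⟩,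
      fun k => ⟨Set.univ, MeasurableSet.univ, huniv, fun ω _ _ _ _ _ _ _ h => absurd h (hvac ω)⟩⟩
  refine ⟨?_, fun k => ?_⟩
  · rcases isEmpty_or_nonempty Ug with hU | hU
    -- Without constraints the confidence level below would be a division by zero, and the claim is
    -- vacuous.
    · exact ⟨Set.univ, MeasurableSet.univ, huniv, fun ω _ _ _ _ _ _ _ _ _ _ _ u => hU.elim u⟩
    have hU' : (1 : ℝ) ≤ Fintype.card Ug := by exact_mod_cast Fintype.card_pos (α := Ug)
    set δ' : ℝ := δ / (Fintype.card 𝒜 * Fintype.card Ug) with hδ'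
    have hδ'0 : 0 < δ' := by positivity
    have hδ'1 : δ' ≤ δ := div_le_self hδ0.le (one_le_mul_of_one_le_of_one_le hA' hU')
    obtain ⟨E, hE, hEQ, hgood⟩ := FedFair.exists_representative_event hP hηhat Q S hS hlaw hind
      Finset.univ (δ := δ') hA hm hn (by
        rw [one_le_div hδ'0]
        refine (hδ'1.trans ‹δ < 1›.le).trans ?_
        exact one_le_mul_of_one_le_of_one_le (one_le_mul_of_one_le_of_one_le hm' hA') hN')
    refine ⟨E, hE, le_trans ?_ hEQ, ?_⟩
    · rw [Finset.card_univ, Fintype.card_fin]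
      -- The union bound over all N clients adds up to exactly δ', which is at most δ.
      have : (N : ℝ) * (Fintype.card 𝒜 * ((m : ℝ) ^ 2 *
          ((m : ℝ) ^ 2 * Fintype.card 𝒜 * N / δ')⁻¹)) = δ' := by
        field_simp
      linarith
    · intro ω hω phat Dghat Dlhat θ h hphat hnmin hopt hns hplug u _
      -- The two signs use different selections but the same event and classifier; together they
      -- bound the absolute value.
      have key : ∀ e : ℝ, e = 1 ∨ e = -1 → _ := fun e he =>
        FedFair.disparity_le (hgood ω hω) hη hηhat hns hplug hP hpm FedFair.pMin_le
          (add_nonneg (Real.sqrt_nonneg _) (Real.sqrt_nonneg _))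
          (FedFair.one_le_card_groupIdx hnmin) (D := Dg u) (Dhat := Dghat u)
          (B := FedFair.normG (Dg u))
          (ε := ⨆ q : 𝒜 × Fin N × Fin m, FedFair.scoreDist P ηhat η q.1 q.2.1 q.2.2)
          (fun a k _ => le_ciSup (f := fun ak : 𝒜 × Fin N => FedFair.l1Norm (Dg u ak.1 ak.2))
            (Set.finite_range _).bddAbove (a, k))
          (fun a k _ i => le_ciSup
            (f := fun q : 𝒜 × Fin N × Fin m => FedFair.scoreDist P ηhat η q.1 q.2.1 q.2.2)
            (Set.finite_range _).bddAbove (a, k, i)) he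
          (FedFair.exists_selection_global hm hphat hopt u e he)
      have k1 := key 1 (Or.inl rfl)
      have k2 := key (-1) (Or.inr rfl)
      -- The term with `nMin` is slack: only its sign matters.
      have hB : 0 ≤ Fintype.card 𝒜 * N * FedFair.normG (Dghat u)
          / (FedFair.nMin (fun k i => S k i ω) : ℝ) := by
        have := FedFair.normG_nonneg (Dghat u)
        positivity
      rw [Finset.card_univ, Fintype.card_fin] at k1 k2
      rw [FedFair.globalDisparity, FedFair.omegaG, abs_le]
      constructor <;> ring_nf at k1 k2 hB ⊢ <;> linarith
  · rcases isEmpty_or_nonempty (Ul k) with hU | hU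
    · exact ⟨Set.univ, MeasurableSet.univ, huniv, fun ω _ _ _ _ _ _ _ _ _ _ _ u => hU.elim u⟩
    have hU' : (1 : ℝ) ≤ Fintype.card (Ul k) := by exact_mod_cast Fintype.card_pos (α := Ul k)
    set δ' : ℝ := N * δ / (Fintype.card 𝒜 * Fintype.card (Ul k)) with hδ'
    have hδ'0 : 0 < δ' := by positivity
    have hδ'1 : δ' ≤ N * δ := div_le_self (by positivity) (one_le_mul_of_one_le_of_one_le hA' hU')
    have hδ'2 : δ' ≤ N := hδ'1.trans (mul_le_of_le_one_right (by positivity) ‹δ < 1›.le)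
    obtain ⟨E, hE, hEQ, hgood⟩ := FedFair.exists_representative_event hP hηhat Q S hS hlaw hind
      {k} (δ := δ') hA hm hn (by
        rw [one_le_div hδ'0]
        exact hδ'2.trans (le_mul_of_one_le_left (by positivity)
          (one_le_mul_of_one_le_of_one_le hm' hA')))
    refine ⟨E, hE, le_trans ?_ hEQ, ?_⟩
    · rw [Finset.card_singleton]
      -- A single client contributes only the fraction 1/N of δ', which compensates the factor N in
      -- the local confidence level.
      have : ((1 : ℕ) : ℝ) * (Fintype.card 𝒜 * ((m : ℝ) ^ 2 *
          ((m : ℝ) ^ 2 * Fintype.card 𝒜 * N / δ')⁻¹)) = δ' / N := by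
        field_simp
        simp
      have h2 : δ' / N ≤ δ := by
        rw [div_le_iff₀ (by positivity)]; linarith
      linarith
    · intro ω hω phat Dghat Dlhat θ h hphat hnmin hopt hns hplug u _
      have key : ∀ e : ℝ, e = 1 ∨ e = -1 → _ := fun e he =>
        FedFair.disparity_le (hgood ω hω) hη hηhat hns hplug hP hpm FedFair.pMin_le
          (add_nonneg (Real.sqrt_nonneg _) (Real.sqrt_nonneg _))
          (FedFair.one_le_card_groupIdx hnmin) (D := fun a _ => Dl k u a)
          (Dhat := fun a _ => Dlhat k u a) (B := FedFair.normL (Dl k u))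
          (ε := ⨆ q : 𝒜 × Fin m, FedFair.scoreDist P ηhat η q.1 k q.2)
          (fun a k' _ => le_ciSup (f := fun a => FedFair.l1Norm (Dl k u a))
            (Set.finite_range _).bddAbove a)
          (fun a k' hk' i => by
            rw [Finset.mem_singleton.1 hk']
            exact le_ciSup (f := fun q : 𝒜 × Fin m => FedFair.scoreDist P ηhat η q.1 k q.2)
              (Set.finite_range _).bddAbove (a, i)) he
          (FedFair.exists_selection_local hm hphat hopt k u e he)
      have k1 := key 1 (Or.inl rfl)
      have k2 := key (-1) (Or.inr rfl)
      have hB : 0 ≤ Fintype.card 𝒜 * FedFair.normL (Dlhat k u)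
          / (FedFair.nMin (fun k i => S k i ω) : ℝ) := by
        have := FedFair.normL_nonneg (Dlhat k u)
        positivity
      simp only [Finset.sum_singleton, Finset.card_singleton, Nat.cast_one] at k1 k2
      rw [FedFair.localDisparity, FedFair.omegaL, abs_le]
      constructor <;> ring_nf at k1 k2 hB ⊢ <;> linarith
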